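/- **Theorem (Monotonicity).** Let $\mathbb{T}=\mathbb{Z}$ or $\mathbb{T}=\mathbb{R}$, $\mathbb{T}^+=\mathbb{T}\cap[0,\infty)$. Let $(\theta_t)_{t\in\mathbb{T}}$ be an ergodic metric dynamical system on a probability space $(\Omega,\mathfrak{F},\mathbb{P})$: $(t,\omega)\mapsto\theta_t\omega$ is measurable, $\theta_0=\mathrm{id}$, $\theta_{t_1+t_2}=\theta_{t_2}\circ\theta_{t_1}$, each $\theta_t$ preserves $\mathbb{P}$, and every $F\in\mathfrak{F}$ that is invariant ($\theta_tF=F$ for all $t\in\mathbb{T}$) has $\mathbb{P}(F)\in\{0,1\}$. If $\mathbb{T}=\mathbb{R}$, $\mathbb{P}$ is complete. Let $X$ be a real Banach space with a cone $X^+$, i.e. a closed convex set with $\alpha X^+\subset X^+$ for $\alpha\ge0$ and $X^+\cap(-X^+)=\{0\}$; write $u\le v$ if $v-u\in X^+$. Let $X^*$ be the dual space and $(X^*)^+=\{u^*\in X^*:\langle u,u^*\rangle\ge0\ \forall u\in X^+\}$. A *measurable linear skew-product semidynamical system* $\Phi=((U_\omega(t)),(\theta_t))$ on $X$ is a family of bounded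 linear operators $U_\omega(t)$ on $X$ ($\omega\in\Omega$, $t\in\mathbb{T}^+$) such that $(t,\omega,u)\mapsto U_\omega(t)u$ is measurable for the product of the Borel $\sigma$-algebra of $\mathbb{T}^+$, $\mathfrak{F}$ and the Borel $\sigma$-algebra of $X$, $U_\omega(0)=\mathrm{Id}$, and $U_{\theta_s\omega}(t)U_\omega(s)=U_\omega(t+s)$. Its *dual* is $\Phi^*=((U^*_\omega(t)),(\theta_{-t}))$ on $X^*$, where $U^*_\omega(t)$ is the adjoint of $U_{\theta_{-t}\omega}(t)$. Say that $\Phi$ satisfies (H) if the following hold. 1. $X$ (with $X^+$) and $X^*$ (with $(X^*)^+$) are separable Banach lattices of dimension at least $2$, with their norms being lattice norms ($|u|\le|v|$ implies $\|u\|\le\|v\|$). 2. Both $\Phi$ and $\Phi^*$ are measurable linear skew-product semidynamical systems, over $(\theta_t)$ and $(\theta_{-t})$ respectively. 3. (Integrability) If $\mathbb{T}=\mathbb{Z}$, then $\ln^+\|U_\omega(1)\|$ is in $L_1(\mathbb{P})$. If $\mathbb{T}=\mathbb{R}$, then $\sup_{0\le s\le1}\ln^+\|U_\omega(s)\|$ and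 $\sup_{0\le s\le1}\ln^+\|U_{\theta_s\omega}(1-s)\|$ are in $L_1(\mathbb{P})$. The same holds for $\Phi^*$ (with $U^*$ and $\theta_{-s}$ in place of $U$ and $\theta_s$). 4. (Positivity) $u_1\le u_2$ implies $U_\omega(t)u_1\le U_\omega(t)u_2$ for all $\omega\in\Omega$, $t\in\mathbb{T}^+$; and likewise for $\Phi^*$ and $(X^*)^+$. 5. (Strong focusing) There are $\mathbf{e}\in X^+$ with $\|\mathbf{e}\|=1$ and a measurable $\varkappa:\Omega\to[1,\infty)$ with $\ln^+\ln\varkappa\in L_1(\mathbb{P})$ such that for every $\omega\in\Omega$ and every nonzero $u\in X^+$ there is $\beta>0$ with $\beta\mathbf{e}\le U_\omega(1)u\le\varkappa(\omega)\beta\mathbf{e}$; there are $\mathbf{e}^*\in(X^*)^+$ and $\varkappa^*$ with the same properties for $\Phi^*$; moreover $\ln\varkappa,\ln\varkappa^*\in L_1(\mathbb{P})$ and $\langle\mathbf{e},\mathbf{e}^*\rangle>0$. A number $\tilde\lambda\in[-\infty,\infty)$ is a *generalized principal Lyapunov exponent* of $\Phi$ if there are an invariant $\tilde\Omega\in\mathfrak{F}$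 with $\mathbb{P}(\tilde\Omega)=1$ and a measurable $w:\tilde\Omega\to X^+\setminus\{0\}$ such that, with $\tilde E(\omega)=\mathrm{span}\{w(\omega)\}$, for all $\omega\in\tilde\Omega$: $U_\omega(t)\tilde E(\omega)=\tilde E(\theta_t\omega)$ for all $t\in\mathbb{T}^+$; $\lim_{t\to\infty}\frac1t\ln\|U_\omega(t)w(\omega)\|=\tilde\lambda$; and $\limsup_{t\to\infty}\frac1t\ln\|U_\omega(t)u\|\le\tilde\lambda$ for all $u\in X\setminus\{0\}$ (with $\ln0=-\infty$ and $t\in\mathbb{T}^+$). Let $\Phi^{(1)}=((U^{(1)}_\omega(t)),(\theta_t))$ and $\Phi^{(2)}=((U^{(2)}_\omega(t)),(\theta_t))$ both satisfy (H) on the same $X$, $X^+$ and over the same $(\theta_t)$, and suppose that for some $t_0\in\mathbb{T}^+\setminus\{0\}$ and $\mathbb{P}$-almost every $\omega\in\Omega$, $$U^{(1)}_\omega(t_0)u\le U^{(2)}_\omega(t_0)u\qquad\text{for all }u\in X^+ .$$ Then each $\Phi^{(i)}$, $i=1,2$, has exactly one generalized principal Lyapunov exponent $\tilde\lambda_1^{(i)}$,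 and $$\tilde\lambda_1^{(1)}\le\tilde\lambda_1^{(2)} .$$ -/

import Mathlib

open MeasureTheory Filter Topology

namespace SkewProduct

/-! ### Time sets -/

/-- The two kinds of time: discrete (`𝕋 = ℤ`) and continuous (`𝕋 = ℝ`). -/
inductive TimeKind : Type
  | discrete
  | continuous

/-- The time group `𝕋` as a subgroup of `ℝ`: the integers or all of `ℝ`.  As a subtype of `ℝ` it
carries the induced order and the Borel `σ`-algebra. -/
def TimeKind.times : TimeKind → AddSubgroup ℝ
  | .discrete => (Int.castAddHom ℝ).range
  | .continuous => ⊤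

theorem TimeKind.one_mem_times (k : TimeKind) : (1 : ℝ) ∈ k.times := by
  cases k
  · exact ⟨1, by simp⟩
  · exact AddSubgroup.mem_top _

/-- The time set `𝕋`. -/
abbrev TimeKind.T (k : TimeKind) : Type := k.times

/-- The set `𝕋⁺` of nonnegative times. -/
abbrev TimeKind.TPos (k : TimeKind) : Type := {t : k.T // 0 ≤ t}

/-- The time `1 ∈ 𝕋⁺`. -/
def TimeKind.one (k : TimeKind) : k.TPos :=
  ⟨⟨1, k.one_mem_times⟩, Subtype.coe_le_coe.mp (by simp)⟩

/-- A nonnegative time as a real number. -/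
def TimeKind.toReal {k : TimeKind} (t : k.TPos) : ℝ := ((t : k.T) : ℝ)

/-! ### Metric dynamical systems -/

section DynamicalSystems

variable {Ω : Type*} [MeasurableSpace Ω] {k : TimeKind}

/-- `Ω'` is invariant: `θ_t(Ω') = Ω'` for all `t ∈ 𝕋`. -/
def IsInvariantSet (θ : k.T → Ω → Ω) (Ω' : Set Ω) : Prop :=
  ∀ t : k.T, θ t '' Ω' = Ω'

/-- `(θ_t)_{t ∈ 𝕋}` is an ergodic metric dynamical system on `(Ω, 𝔉, μ)`. -/
structure IsErgodicMetricDS (μ : Measure Ω) (θ : k.T → Ω → Ω) : Prop where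
  measurable : Measurable fun p : k.T × Ω => θ p.1 p.2
  map_zero : ∀ ω, θ 0 ω = ω
  map_add : ∀ (t₁ t₂ : k.T) (ω : Ω), θ (t₁ + t₂) ω = θ t₂ (θ t₁ ω)
  preserving : ∀ t, MeasurePreserving (θ t) μ μ
  ergodic : ∀ F : Set Ω, MeasurableSet F → IsInvariantSet θ F → μ F = 1 ∨ μ F = 0

/-- The time-reversed system `(θ_{-t})_{t ∈ 𝕋}`. -/
def timeReversal (θ : k.T → Ω → Ω) : k.T → Ω → Ω := fun t => θ (-t)

end DynamicalSystems

/-! ### Measurable linear skew-product semidynamical systems -/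

section Systems

variable {Ω : Type*} {k : TimeKind}
  {X : Type*} [NormedAddCommGroup X] [NormedSpace ℝ X]

/-- `((U_ω(t))_{ω ∈ Ω, t ∈ 𝕋⁺}, (θ_t)_{t ∈ 𝕋})` is a measurable linear skew-product semidynamical
system on `X`; here `U t ω` is the bounded linear operator `U_ω(t)`. -/
structure IsMLSPS [MeasurableSpace Ω] [MeasurableSpace X] (θ : k.T → Ω → Ω)
    (U : k.TPos → Ω → X →L[ℝ] X) : Prop where
  measurable : Measurable fun p : k.TPos × Ω × X => U p.1 p.2.1 p.2.2
  map_zero : ∀ ω, U 0 ω = ContinuousLinearMap.id ℝ X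
  cocycle : ∀ (ω : Ω) (t s : k.TPos), (U t (θ (s : k.T) ω)).comp (U s ω) = U (t + s) ω

/-- The dual family `U*_ω(t)`, where `⟨u, U*_ω(t) u*⟩ = ⟨U_{θ_{-t}ω}(t) u, u*⟩`. -/
noncomputable def dualFamily (θ : k.T → Ω → Ω) (U : k.TPos → Ω → X →L[ℝ] X) :
    k.TPos → Ω → StrongDual ℝ X →L[ℝ] StrongDual ℝ X :=
  fun t ω => (ContinuousLinearMap.compL ℝ X X ℝ).flip (U t (θ (-(t : k.T)) ω))

theorem dualFamily_apply (θ : k.T → Ω → Ω) (U : k.TPos → Ω → X →L[ℝ] X)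
    (t : k.TPos) (ω : Ω) (f : StrongDual ℝ X) (u : X) :
    dualFamily θ U t ω f u = f (U t (θ (-(t : k.T)) ω) u) := rfl

end Systems

/-! ### Ordered Banach spaces -/

section Cones

variable {X : Type*} [NormedAddCommGroup X] [NormedSpace ℝ X]

/-- A cone in a Banach space. -/
structure IsCone (C : Set X) : Prop where
  isClosed : IsClosed C
  convex : Convex ℝ C
  smul_mem : ∀ (a : ℝ) (u : X), 0 ≤ a → u ∈ C → a • u ∈ C
  inter_neg : C ∩ (-C) = {0}

/-- The order `u ≤ v` given by the cone `C`. -/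
def ConeLE (C : Set X) (u v : X) : Prop := v - u ∈ C

/-- The set `(X*)⁺` of bounded linear functionals that are nonnegative on `C`. -/
def dualCone (C : Set X) : Set (StrongDual ℝ X) := {f | ∀ u ∈ C, 0 ≤ f u}

/-- `(X, C)` is an ordered separable Banach space of dimension at least two. -/
structure IsOrderedSeparableBanach (C : Set X) : Prop where
  cone : IsCone C
  complete : CompleteSpace X
  separable : TopologicalSpace.SeparableSpace X
  two_le_dim : 2 ≤ Module.rank ℝ X

/-- `(X, C)` is a separable Banach lattice of dimension at least two, with a lattice norm:
the order of the cone `C` is a lattice order, and `|u| ≤ |v|` implies `‖u‖ ≤ ‖v‖`. -/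
structure IsSeparableBanachLattice (C : Set X) : Prop extends IsOrderedSeparableBanach C where
  lattice : ∃ _ : Lattice X, (∀ u v : X, u ≤ v ↔ ConeLE C u v) ∧
    ∀ u v : X, |u| ≤ |v| → ‖u‖ ≤ ‖v‖

end Cones

/-! ### Assumptions on a system -/

section Assumptions

variable {Ω : Type*} [MeasurableSpace Ω] {k : TimeKind}
  {X : Type*} [NormedAddCommGroup X] [NormedSpace ℝ X] [MeasurableSpace X]

/-- The integrability assumption, for a system on a separable Banach space covering an ergodic
metric dynamical system (over a complete measure if time is continuous).  In continuous time the
suprema are taken in `[0, ∞]`, so that their integrability includes their finiteness almost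
everywhere; the second one runs over `s, r ≥ 0` with `s + r = 1`, that is `r = 1 - s`. -/
structure Integrability (μ : Measure Ω) (θ : k.T → Ω → Ω) (U : k.TPos → Ω → X →L[ℝ] X) :
    Prop where
  separable : TopologicalSpace.SeparableSpace X
  base : IsErgodicMetricDS μ θ
  system : IsMLSPS θ U
  isComplete : k = .continuous → μ.IsComplete
  discrete : k = .discrete → Integrable (fun ω => Real.posLog ‖U k.one ω‖) μ
  continuous : k = .continuous →
    (AEMeasurable (fun ω => ⨆ s : {s : k.TPos // s ≤ k.one},
        ENNReal.ofReal (Real.posLog ‖U s ω‖)) μ ∧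
      ∫⁻ ω, (⨆ s : {s : k.TPos // s ≤ k.one},
        ENNReal.ofReal (Real.posLog ‖U s ω‖)) ∂μ < ⊤) ∧
    (AEMeasurable (fun ω => ⨆ p : {p : k.TPos × k.TPos // p.1 + p.2 = k.one},
        ENNReal.ofReal (Real.posLog ‖U p.1.2 (θ (p.1.1 : k.T) ω)‖)) μ ∧
      ∫⁻ ω, (⨆ p : {p : k.TPos × k.TPos // p.1 + p.2 = k.one},
        ENNReal.ofReal (Real.posLog ‖U p.1.2 (θ (p.1.1 : k.T) ω)‖)) ∂μ < ⊤)

/-- The positivity assumption, for the cone `C`. -/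
structure Positivity (μ : Measure Ω) (θ : k.T → Ω → Ω) (U : k.TPos → Ω → X →L[ℝ] X) (C : Set X) :
    Prop where
  space : IsOrderedSeparableBanach C
  base : IsErgodicMetricDS μ θ
  system : IsMLSPS θ U
  monotone : ∀ (ω : Ω) (t : k.TPos) (u₁ u₂ : X), ConeLE C u₁ u₂ →
    ConeLE C (U t ω u₁) (U t ω u₂)

/-- The focusing assumption, with the vector `e` and the function `κ`. -/
structure Focusing (μ : Measure Ω) (θ : k.T → Ω → Ω) (U : k.TPos → Ω → X →L[ℝ] X) (C : Set X)
    (e : X) (κ : Ω → ℝ) : Prop where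
  positivity : Positivity μ θ U C
  e_mem : e ∈ C
  norm_e : ‖e‖ = 1
  measurable : Measurable κ
  one_le : ∀ ω, 1 ≤ κ ω
  integrable : Integrable (fun ω => Real.posLog (Real.log (κ ω))) μ
  focusing : ∀ (ω : Ω) (u : X), u ∈ C → u ≠ 0 → ∃ β : ℝ, 0 < β ∧
    ConeLE C (β • e) (U k.one ω u) ∧ ConeLE C (U k.one ω u) ((κ ω * β) • e)

end Assumptions

section StrongFocusing

variable {Ω : Type*} [MeasurableSpace Ω] {k : TimeKind}
  {X : Type*} [NormedAddCommGroup X] [NormedSpace ℝ X] [MeasurableSpace X]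

/-- The strong focusing assumption: the system and its dual are focusing, with integrable
logarithms `ln κ`, `ln κ*` and with `⟨e, e*⟩ > 0`. -/
def StrongFocusing (μ : Measure Ω) (θ : k.T → Ω → Ω) (U : k.TPos → Ω → X →L[ℝ] X) (C : Set X) :
    Prop :=
  ∃ (e : X) (κ : Ω → ℝ) (e' : StrongDual ℝ X) (κ' : Ω → ℝ),
    Focusing μ θ U C e κ ∧
    Focusing μ (timeReversal θ) (dualFamily θ U) (dualCone C) e' κ' ∧
    Integrable (fun ω => Real.log (κ ω)) μ ∧
    Integrable (fun ω => Real.log (κ' ω)) μ ∧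
    0 < e' e

/-- The hypotheses on a system under which generalized exponential separation holds. -/
structure SeparationHypotheses (μ : Measure Ω) (θ : k.T → Ω → Ω) (U : k.TPos → Ω → X →L[ℝ] X)
    (C : Set X) : Prop where
  lattice : IsSeparableBanachLattice C
  integrability : Integrability μ θ U
  positivity : Positivity μ θ U C
  dual_lattice : IsSeparableBanachLattice (dualCone C)
  dual_integrability : Integrability μ (timeReversal θ) (dualFamily θ U)
  dual_positivity : Positivity μ (timeReversal θ) (dualFamily θ U) (dualCone C)
  strongFocusing : StrongFocusing μ θ U C

/-! ### Generalized principal Floquet subspaces and the principal Lyapunov exponent -/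

/-- The growth rate `(1 / t) ln ‖U_ω(t) u‖` in `[-∞, ∞]`, with `ln 0 = -∞`. -/
noncomputable def growthRate (U : k.TPos → Ω → X →L[ℝ] X) (ω : Ω) (u : X) (t : k.TPos) : EReal :=
  ((1 / TimeKind.toReal t : ℝ) : EReal) * ENNReal.log ‖U t ω u‖ₑ

/-- `{E(ω)}_{ω ∈ Ω'}`, with `E(ω)` spanned by the positive vector `w(ω)`, is a family of generalized
principal Floquet subspaces, with the associated exponent `l`.  Only the values of `E` and `w` on
`Ω'` matter. -/
structure IsPrincipalFloquetFamily (μ : Measure Ω) (θ : k.T → Ω → Ω)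
    (U : k.TPos → Ω → X →L[ℝ] X) (C : Set X) (Ω' : Set Ω) (E : Ω → Submodule ℝ X) (w : Ω → X)
    (l : EReal) : Prop where
  measurableSet : MeasurableSet Ω'
  invariant : IsInvariantSet θ Ω'
  measure_eq_one : μ Ω' = 1
  measurable : Measurable fun ω : Ω' => w ω
  pos : ∀ ω ∈ Ω', w ω ∈ C ∧ w ω ≠ 0
  eq_span : ∀ ω ∈ Ω', E ω = Submodule.span ℝ {w ω}
  map_eq : ∀ ω ∈ Ω', ∀ t : k.TPos, (E ω).map (U t ω).toLinearMap = E (θ (t : k.T) ω)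
  ne_top : l ≠ ⊤
  tendsto : ∀ ω ∈ Ω', Tendsto (growthRate U ω (w ω)) atTop (𝓝 l)
  limsup_le : ∀ ω ∈ Ω', ∀ u : X, u ≠ 0 → limsup (growthRate U ω u) atTop ≤ l

/-- `l` is a generalized principal Lyapunov exponent of the system: it is associated to some family
of generalized principal Floquet subspaces. -/
def IsPrincipalLyapunovExponent (μ : Measure Ω) (θ : k.T → Ω → Ω)
    (U : k.TPos → Ω → X →L[ℝ] X) (C : Set X) (l : EReal) : Prop :=
  ∃ (Ω' : Set Ω) (E : Ω → Submodule ℝ X) (w : Ω → X), IsPrincipalFloquetFamily μ θ U C Ω' E w l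

end StrongFocusing

end SkewProduct

/-!
*Invariant directions.* For nonnegative `u`, `v` measure the relative oscillation `ε` of `u` with
respect to `v` by `m v ≤ u ≤ (1 + ε) m v` (`IsClose`). If `A` sends every nonzero nonnegative vector
into an order interval `[β e, κ β e]`, then `A` makes the oscillation of any two such vectors at
most `κ² - 1` and multiplies it by at most `1 - κ⁻²`, a form of Birkhoff's contraction theorem
(`FocusesOn.isClose_map`, `FocusesOn.isClose_map_of_isClose`). By Poincaré recurrence of the sets
`{κ ≤ K}` the product of these factors along almost every backward orbit vanishes
(`Focusing.ae_isContracting`). Hence the directions of `U_{θ_{-t} ω}(t) u` converge, as `t → ∞`, to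
one direction `w ω` that does not depend on `u`, is measurable in `ω` and is equivariant
(`Focusing.exists_equivariant_direction`).

*Existence.* The logarithm of `‖U_ω(n) w(ω)‖` is a Birkhoff sum of `ln ‖U_ω(1) w(ω)‖` under `θ_1`.
The positive part of this function is integrable, so the averages converge almost everywhere in
`[-∞, ∞)` (`ae_exists_tendsto_birkhoffSum_div`). The integrability assumptions carry the limit over
from integer to real times, and ergodicity of the whole flow makes it constant. It bounds the upper
growth rate of every vector `u = p - q`, since focusing gives `U_ω(1) p ≤ c U_ω(1) w(ω)` for
nonnegative `p` (`Focusing.limsup_growthRate_le`).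

*Comparison and uniqueness.* If `U₁(t₀) ≤ U₂(t₀)` on the cone, then the same holds at all multiples
of `t₀`. At one point common to the two Floquet families the first principal vector then grows at
rate `l₁` under `U₁`, at most as fast under `U₁` as under `U₂`, and with upper rate at most `l₂`
under `U₂` (`IsPrincipalLyapunovExponent.le_of_le`). Comparing a system with itself gives
uniqueness.
-/

open MeasureTheory Filter Topology

namespace SkewProduct

/-! ### The pointwise ergodic theorem -/

section Ergodic

variable {α : Type*}

/-- `maxSum T f n` is the maximum of `0` and of the Birkhoff sums `S_1 f, …, S_n f`, defined by the
recursion `M_{n+1} = max(0, f + M_n ∘ T)`. -/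
noncomputable def maxSum (T : α → α) (f : α → ℝ) : ℕ → α → ℝ
  | 0 => fun _ => 0
  | n + 1 => fun x => max 0 (f x + maxSum T f n (T x))

theorem maxSum_nonneg (T : α → α) (f : α → ℝ) (n : ℕ) (x : α) : 0 ≤ maxSum T f n x := by
  cases n with
  | zero => exact le_rfl
  | succ n => exact le_max_left _ _

theorem maxSum_le_succ (T : α → α) (f : α → ℝ) (n : ℕ) (x : α) :
    maxSum T f n x ≤ maxSum T f (n + 1) x := by
  induction n generalizing x with
  | zero => exact maxSum_nonneg T f 1 x
  | succ n ih => exact max_le_max le_rfl (by gcongr; exact ih _)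

theorem birkhoffSum_le_maxSum (T : α → α) (f : α → ℝ) (n : ℕ) (x : α) :
    birkhoffSum T f n x ≤ maxSum T f n x := by
  induction n generalizing x with
  | zero => simp [maxSum]
  | succ n ih =>
    rw [birkhoffSum_succ']
    exact le_max_of_le_right (by gcongr; exact ih _)

/-- The set where the Birkhoff sums of `f - b` are unbounded above. It is exactly invariant, and
contains every point at which the upper limit of the Birkhoff averages exceeds `b`. -/
def unboundedSet (T : α → α) (f : α → ℝ) (b : ℝ) : Set α :=
  {x | ¬ BddAbove (Set.range fun n : ℕ => birkhoffSum T f n x - n * b)}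

theorem preimage_unboundedSet (T : α → α) (f : α → ℝ) (b : ℝ) :
    T ⁻¹' unboundedSet T f b = unboundedSet T f b := by
  ext x
  have key : ∀ n : ℕ, birkhoffSum T f n (T x) - n * b =
      birkhoffSum T f (n + 1) x - (n + 1 : ℕ) * b + (b - f x) := by
    intro n
    rw [birkhoffSum_succ']
    push_cast
    ring
  refine not_congr ⟨?_, ?_⟩
  · rintro ⟨M, hM⟩
    refine ⟨max 0 (M - (b - f x)), ?_⟩
    rintro _ ⟨n, rfl⟩
    cases n with
    | zero => simp
    | succ n =>
      have := hM ⟨n, rfl⟩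
      simp only [key] at this ⊢
      exact le_max_of_le_right (by linarith)
  · rintro ⟨M, hM⟩
    refine ⟨M + (b - f x), ?_⟩
    rintro _ ⟨n, rfl⟩
    have := hM ⟨n + 1, rfl⟩
    simp only [key] at this ⊢
    linarith

variable [MeasurableSpace α]

theorem measurable_maxSum {T : α → α} {f : α → ℝ} (hT : Measurable T) (hf : Measurable f)
    (n : ℕ) : Measurable (maxSum T f n) := by
  induction n with
  | zero => exact measurable_const
  | succ n ih => exact measurable_const.max (hf.add (ih.comp hT))

theorem integrable_maxSum {ν : Measure α} {T : α → α} {f : α → ℝ}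
    (hT : MeasurePreserving T ν ν) (hf : Integrable f ν) (n : ℕ) :
    Integrable (maxSum T f n) ν := by
  induction n with
  | zero => exact integrable_zero _ _ _
  | succ n ih =>
    exact (integrable_zero _ _ _).sup (hf.add (hT.integrable_comp_of_integrable ih))

/-- The maximal ergodic inequality, when almost every point has a positive Birkhoff sum. -/
theorem integral_nonneg_of_exists_birkhoffSum_pos {ν : Measure α} {T : α → α} {f : α → ℝ}
    (hT : MeasurePreserving T ν ν) (hfm : Measurable f) (hf : Integrable f ν)
    (hpos : ∀ᵐ x ∂ν, ∃ n, 0 < birkhoffSum T f n x) : 0 ≤ ∫ x, f x ∂ν := by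
  set A : ℕ → Set α := fun n => {x | 0 < maxSum T f n x} with hA
  have hAm : ∀ n, MeasurableSet (A n) := fun n =>
    measurableSet_lt measurable_const (measurable_maxSum hT.measurable hfm n)
  have hmono : Monotone A := monotone_nat_of_le_succ fun n x hx =>
    lt_of_lt_of_le hx (maxSum_le_succ T f n x)
  have hstep : ∀ n, 0 ≤ ∫ x in A n, f x ∂ν := by
    intro n
    have hI := integrable_maxSum hT hf n
    have hIT : Integrable (fun x => maxSum T f n (T x)) ν := hT.integrable_comp_of_integrable hI
    have h0 : ∫ x, (maxSum T f n x - maxSum T f n (T x)) ∂ν = 0 := by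
      rw [integral_sub hI hIT]
      have h2 : ∫ x, maxSum T f n (T x) ∂ν = ∫ x, maxSum T f n x ∂ν := by
        conv_rhs => rw [← hT.map_eq]
        rw [integral_map hT.measurable.aemeasurable
          (measurable_maxSum hT.measurable hfm n).aestronglyMeasurable]
      rw [h2, sub_self]
    -- On `A n` one has `maxSum T f n ≤ f + maxSum T f n ∘ T`, so that `f` dominates a function
    -- with integral `0`.
    rw [← integral_indicator (hAm n), ← h0]
    refine integral_mono (hI.sub hIT) (hf.indicator (hAm n)) fun x => ?_
    by_cases hx : x ∈ A n
    · rw [Set.indicator_of_mem hx]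
      cases n with
      | zero => exact absurd hx (lt_irrefl (0 : ℝ))
      | succ n =>
        have hx' : 0 < max 0 (f x + maxSum T f n (T x)) := hx
        have h1 : maxSum T f (n + 1) x = f x + maxSum T f n (T x) := by
          rcases lt_max_iff.1 hx' with h | h
          · exact absurd h (lt_irrefl _)
          · exact max_eq_right h.le
        have h2 := maxSum_le_succ T f n (T x)
        simp only
        linarith
    · rw [Set.indicator_of_notMem hx]
      have h1 : maxSum T f n x ≤ 0 := not_lt.1 hx
      have h2 := maxSum_nonneg T f n (T x)
      simp only
      linarith
  have hlim := tendsto_setIntegral_of_monotone hAm hmono hf.integrableOn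
  have hU : (⋃ n, A n) =ᵐ[ν] (Set.univ : Set α) := by
    refine eventuallyEq_univ.2 ?_
    filter_upwards [hpos] with x ⟨n, hn⟩
    exact Set.mem_iUnion.2 ⟨n, lt_of_lt_of_le hn (birkhoffSum_le_maxSum T f n x)⟩
  rw [setIntegral_congr_set hU, setIntegral_univ] at hlim
  exact ge_of_tendsto' hlim hstep

theorem measurable_birkhoffSum {T : α → α} {f : α → ℝ} (hT : Measurable T) (hf : Measurable f)
    (n : ℕ) : Measurable (birkhoffSum T f n) := by
  unfold birkhoffSum
  exact Finset.measurable_sum _ fun i _ => hf.comp (hT.iterate i)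

theorem measurableSet_unboundedSet {T : α → α} {f : α → ℝ} (hT : Measurable T)
    (hf : Measurable f) (b : ℝ) : MeasurableSet (unboundedSet T f b) :=
  (measurableSet_bddAbove_range fun n =>
    (measurable_birkhoffSum hT hf n).sub measurable_const).compl

/-- If the Birkhoff sums of `f - b` are almost everywhere unbounded above, and the positive part of
`f` is integrable, then `f` is integrable with mean at least `b`. -/
theorem integrable_of_ae_mem_unboundedSet {ν : Measure α} [IsFiniteMeasure ν] {T : α → α}
    {f : α → ℝ} (hT : MeasurePreserving T ν ν) (hfm : Measurable f)
    (hf : Integrable (fun x => max (f x) 0) ν) (b : ℝ)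
    (hb : ∀ᵐ x ∂ν, x ∈ unboundedSet T f b) :
    Integrable f ν ∧ b * ν.real Set.univ ≤ ∫ x, f x ∂ν := by
  have hexists : ∀ (g : α → ℝ), (∀ x, f x ≤ g x) →
      ∀ᵐ x ∂ν, ∃ n, 0 < birkhoffSum T (fun y => g y - b) n x := by
    intro g hg
    filter_upwards [hb] with x hx
    obtain ⟨_, ⟨n, rfl⟩, hn⟩ := not_bddAbove_iff.1 hx 0
    refine ⟨n, hn.trans_le ?_⟩
    simp only [birkhoffSum, Finset.sum_sub_distrib, Finset.sum_const, Finset.card_range,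
      nsmul_eq_mul]
    gcongr
    exact hg _
  have hmean : ∀ g : α → ℝ, (∀ x, f x ≤ g x) → Measurable g → Integrable g ν →
      b * ν.real Set.univ ≤ ∫ x, g x ∂ν := by
    intro g hg hgm hgi
    have := integral_nonneg_of_exists_birkhoffSum_pos hT (hgm.sub measurable_const)
      (hgi.sub (integrable_const b)) (hexists g hg)
    simp only [Pi.sub_apply] at this
    rw [integral_sub hgi (integrable_const b), integral_const, smul_eq_mul] at this
    linarith
  -- The negative part is integrable by monotone convergence along its truncations.
  have hneg : Integrable (fun x => max (-f x) 0) ν := by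
    set h : ℕ → α → ℝ := fun M x => min (max (-f x) 0) M with hh
    have hm : ∀ M, Measurable (h M) := fun M =>
      (hfm.neg.max measurable_const).min measurable_const
    have hnn : ∀ M x, 0 ≤ h M x := fun M x => le_min (le_max_right _ _) (Nat.cast_nonneg _)
    have hi : ∀ M, Integrable (h M) ν := fun M =>
      Integrable.of_bound (hm M).aestronglyMeasurable (M : ℝ) (Eventually.of_forall fun x => by
        rw [Real.norm_of_nonneg (hnn M x)]; exact min_le_right _ _)
    have hbd : ∀ M, ∫ x, h M x ∂ν ≤ ∫ x, max (f x) 0 ∂ν - b * ν.real Set.univ := by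
      intro M
      have := hmean (fun x => max (f x) 0 - h M x) (fun x => by
        have : h M x ≤ max (-f x) 0 := min_le_left _ _
        rcases le_total 0 (f x) with h0 | h0
        · rw [max_eq_right (by linarith)] at this
          have := le_max_left (f x) 0
          linarith
        · rw [max_eq_left (by linarith)] at this
          have := le_max_right (f x) 0
          linarith) ((hfm.max measurable_const).sub (hm M)) (hf.sub (hi M))
      rw [integral_sub hf (hi M)] at this
      linarith
    refine ⟨(hfm.neg.max measurable_const).aestronglyMeasurable, ?_⟩
    rw [hasFiniteIntegral_iff_ofReal (f := fun x => max (-f x) 0)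
      (Eventually.of_forall fun x => le_max_right _ _)]
    have hsup : ∀ x, ENNReal.ofReal (max (-f x) 0) = ⨆ M, ENNReal.ofReal (h M x) := by
      intro x
      refine le_antisymm ?_ (iSup_le fun M => ENNReal.ofReal_le_ofReal (min_le_left _ _))
      obtain ⟨M, hM⟩ := exists_nat_ge (max (-f x) 0)
      refine le_iSup_of_le M (ENNReal.ofReal_le_ofReal ?_)
      exact le_min le_rfl hM
    simp_rw [hsup]
    rw [lintegral_iSup (fun M => (hm M).ennreal_ofReal) (fun M N hMN x =>
      ENNReal.ofReal_le_ofReal (min_le_min le_rfl (Nat.cast_le.2 hMN)))]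
    refine lt_of_le_of_lt (iSup_le fun M => ?_)
      (ENNReal.ofReal_lt_top (r := ∫ x, max (f x) 0 ∂ν - b * ν.real Set.univ))
    rw [← ofReal_integral_eq_lintegral_ofReal (hi M) (Eventually.of_forall (hnn M))]
    exact ENNReal.ofReal_le_ofReal (hbd M)
  have hfi : Integrable f ν := by
    refine (hf.sub hneg).congr (Eventually.of_forall fun x => ?_)
    simp only [Pi.sub_apply]
    rcases le_total 0 (f x) with h0 | h0
    · rw [max_eq_left h0, max_eq_right (by linarith), sub_zero]
    · rw [max_eq_right h0, max_eq_left (by linarith)]; ring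
  exact ⟨hfi, hmean f (fun _ => le_rfl) hfm hfi⟩

/-- Birkhoff's pointwise ergodic theorem for a function whose positive part is integrable: the
averages converge almost everywhere in `[-∞, ∞)`. -/
theorem ae_exists_tendsto_birkhoffSum_div {μ : Measure α} [IsFiniteMeasure μ] {T : α → α}
    {f : α → ℝ} (hT : MeasurePreserving T μ μ) (hfm : Measurable f)
    (hf : Integrable (fun x => max (f x) 0) μ) :
    ∀ᵐ x ∂μ, ∃ L : EReal, L ≠ ⊤ ∧
      Tendsto (fun n : ℕ => ((birkhoffSum T f n x / n : ℝ) : EReal)) atTop (𝓝 L) := by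
  have hres : ∀ E : Set α, MeasurableSet E → T ⁻¹' E = E →
      MeasurePreserving T (μ.restrict E) (μ.restrict E) := by
    intro E hE hTE
    have := hT.restrict_preimage hE
    rwa [hTE] at this
  have hfneg : Measurable fun x => -f x := hfm.neg
  have hcross : ∀ a b : ℚ, a < b →
      ∀ᵐ x ∂μ, ¬ (x ∈ unboundedSet T f b ∧ x ∈ unboundedSet T (fun x => -f x) (-a : ℝ)) := by
    intro a b hab
    set E := unboundedSet T f b ∩ unboundedSet T (fun x => -f x) (-a : ℝ) with hEdef
    have hE : MeasurableSet E := (measurableSet_unboundedSet hT.measurable hfm _).inter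
      (measurableSet_unboundedSet hT.measurable hfneg _)
    have hTE : T ⁻¹' E = E := by
      rw [hEdef, Set.preimage_inter, preimage_unboundedSet, preimage_unboundedSet]
    have h1 := integrable_of_ae_mem_unboundedSet (hres E hE hTE) hfm hf.integrableOn (b : ℝ)
      ((ae_restrict_mem hE).mono fun x hx => hx.1)
    have h2 := integrable_of_ae_mem_unboundedSet (hres E hE hTE) hfneg
      (h1.1.neg.sup (integrable_zero _ _ _)) (-a : ℝ)
      ((ae_restrict_mem hE).mono fun x hx => hx.2)
    have h3 := h2.2
    rw [integral_neg] at h3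
    have hab' : (a : ℝ) < b := by exact_mod_cast hab
    have hz : (μ.restrict E).real Set.univ = 0 := by
      have h0 : 0 ≤ (μ.restrict E).real Set.univ := measureReal_nonneg
      nlinarith [h1.2]
    rw [measureReal_restrict_apply_univ, measureReal_eq_zero_iff] at hz
    exact measure_eq_zero_iff_ae_notMem.1 hz
  have htop : ∀ᵐ x ∂μ, ∃ b : ℕ, x ∉ unboundedSet T f b := by
    set E := ⋂ b : ℕ, unboundedSet T f b with hEdef
    have hE : MeasurableSet E :=
      MeasurableSet.iInter fun b => measurableSet_unboundedSet hT.measurable hfm _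
    have hTE : T ⁻¹' E = E := by
      rw [hEdef, Set.preimage_iInter]
      simp_rw [preimage_unboundedSet]
    have h1 : ∀ b : ℕ, _ := fun b =>
      (integrable_of_ae_mem_unboundedSet (hres E hE hTE) hfm hf.integrableOn (b : ℝ)
      ((ae_restrict_mem hE).mono fun x hx => Set.mem_iInter.1 hx b)).2
    have hz : (μ.restrict E).real Set.univ = 0 := by
      by_contra hne
      have h0 : 0 < (μ.restrict E).real Set.univ :=
        lt_of_le_of_ne measureReal_nonneg (Ne.symm hne)
      obtain ⟨b, hb⟩ := exists_nat_gt ((∫ x in E, f x ∂μ) / (μ.restrict E).real Set.univ)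
      rw [div_lt_iff₀ h0] at hb
      exact absurd (h1 b) (not_le.2 hb)
    rw [measureReal_restrict_apply_univ, measureReal_eq_zero_iff] at hz
    filter_upwards [measure_eq_zero_iff_ae_notMem.1 hz] with x hx
    simpa [hEdef] using hx
  have hcross' : ∀ᵐ x ∂μ, ∀ a b : ℚ, a < b →
      ¬ (x ∈ unboundedSet T f b ∧ x ∈ unboundedSet T (fun x => -f x) (-a : ℝ)) :=
    ae_all_iff.2 fun a => ae_all_iff.2 fun b => ae_all_iff.2 (hcross a b)
  filter_upwards [hcross', htop] with x hx ⟨b₀, hb₀⟩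
  have hup : ∀ b b' : ℝ, b < b' → (∃ᶠ n : ℕ in atTop, b' < birkhoffSum T f n x / n) →
      x ∈ unboundedSet T f b := by
    intro b b' hbb hfr ⟨M, hM⟩
    have hev : ∀ᶠ n : ℕ in atTop, M < n * (b' - b) ∧ 0 < n :=
      ((tendsto_natCast_atTop_atTop.atTop_mul_const (sub_pos.2 hbb)).eventually_gt_atTop M).and
        (eventually_gt_atTop 0)
    obtain ⟨n, hn, hn1, hn0⟩ := (hfr.and_eventually hev).exists
    have hn0' : (0 : ℝ) < n := Nat.cast_pos.2 hn0
    rw [lt_div_iff₀ hn0'] at hn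
    have := hM ⟨n, rfl⟩
    simp only at this
    nlinarith
  have hdown : ∀ a a' : ℝ, a' < a → (∃ᶠ n : ℕ in atTop, birkhoffSum T f n x / n < a') →
      x ∈ unboundedSet T (fun x => -f x) (-a) := by
    intro a a' haa hfr ⟨M, hM⟩
    have hev : ∀ᶠ n : ℕ in atTop, M < n * (a - a') ∧ 0 < n :=
      ((tendsto_natCast_atTop_atTop.atTop_mul_const (sub_pos.2 haa)).eventually_gt_atTop M).and
        (eventually_gt_atTop 0)
    obtain ⟨n, hn, hn1, hn0⟩ := (hfr.and_eventually hev).exists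
    have hn0' : (0 : ℝ) < n := Nat.cast_pos.2 hn0
    rw [div_lt_iff₀ hn0'] at hn
    have := hM ⟨n, rfl⟩
    simp only [birkhoffSum, Finset.sum_neg_distrib] at this hn
    nlinarith
  obtain ⟨L, hL⟩ : ∃ L : EReal,
      Tendsto (fun n : ℕ => ((birkhoffSum T f n x / n : ℝ) : EReal)) atTop (𝓝 L) := by
    refine tendsto_of_no_upcrossings dense_univ ?_
    rintro a - b - hab ⟨ha, hb⟩
    obtain ⟨q₁, hq₁, hq₁b⟩ := EReal.exists_rat_btwn_of_lt hab
    obtain ⟨q₂, hq₂, hq₂b⟩ := EReal.exists_rat_btwn_of_lt hq₁b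
    obtain ⟨q₃, hq₃, hq₃b⟩ := EReal.exists_rat_btwn_of_lt hq₂b
    obtain ⟨q₄, hq₄, hq₄b⟩ := EReal.exists_rat_btwn_of_lt hq₃b
    refine hx q₂ q₃ (by exact_mod_cast hq₃) ⟨hup q₃ q₄ (by exact_mod_cast hq₄) ?_,
      hdown q₂ q₁ (by exact_mod_cast hq₂) ?_⟩
    · exact hb.mono fun n hn => EReal.coe_lt_coe_iff.1 (hq₄b.trans hn)
    · exact ha.mono fun n hn => EReal.coe_lt_coe_iff.1 (hn.trans hq₁)
  refine ⟨L, ?_, hL⟩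
  rintro rfl
  refine hb₀ (hup b₀ (b₀ + 1) (by linarith) (Eventually.frequently ?_))
  have := hL.eventually (lt_mem_nhds (EReal.coe_lt_top ((b₀ : ℝ) + 1)))
  exact this.mono fun n hn => EReal.coe_lt_coe_iff.1 hn

/-- Along almost every orbit an integrable function grows sublinearly. -/
theorem ae_tendsto_comp_iterate_div {μ : Measure α} [IsProbabilityMeasure μ] {T : α → α}
    {g : α → ℝ} (hT : MeasurePreserving T μ μ) (hgm : Measurable g) (hg : Integrable g μ)
    (hg0 : ∀ x, 0 ≤ g x) :
    ∀ᵐ x ∂μ, Tendsto (fun n : ℕ => g (T^[n] x) / n) atTop (𝓝 0) := by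
  have h : ∀ k : ℕ, ∀ᵐ x ∂μ, ∀ᶠ n : ℕ in atTop, (k + 1 : ℝ) * g (T^[n] x) ≤ n := by
    intro k
    let _ : MeasureSpace α := ⟨μ⟩
    have : IsProbabilityMeasure (volume : Measure α) := ‹IsProbabilityMeasure μ›
    have hs := ProbabilityTheory.tsum_prob_mem_Ioi_lt_top (X := fun x => (k + 1 : ℝ) * g x)
      (hg.const_mul _) (fun x => mul_nonneg (by positivity) (hg0 x))
    have hs' : (∑' n : ℕ, μ {x | (k + 1 : ℝ) * g (T^[n] x) ∈ Set.Ioi (n : ℝ)}) < ⊤ := by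
      convert hs using 3 with n
      have hm : MeasurableSet {x | (k + 1 : ℝ) * g x ∈ Set.Ioi (n : ℝ)} :=
        measurableSet_lt measurable_const (hgm.const_mul _)
      exact (hT.iterate n).measure_preimage hm.nullMeasurableSet
    filter_upwards [ae_eventually_notMem hs'.ne] with x hx
    filter_upwards [hx] with n hn
    simpa using hn
  filter_upwards [ae_all_iff.2 h] with x hx
  rw [Metric.tendsto_atTop']
  intro ε hε
  obtain ⟨k, hk⟩ := exists_nat_one_div_lt hε
  obtain ⟨N, hN⟩ := eventually_atTop.1 (hx k)
  refine ⟨N, fun n hn => ?_⟩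
  have hn0 : (0 : ℝ) < n := by exact_mod_cast (Nat.zero_le N).trans_lt hn
  rw [dist_zero_right, Real.norm_of_nonneg (div_nonneg (hg0 _) hn0.le)]
  refine lt_of_le_of_lt ?_ hk
  rw [div_le_div_iff₀ hn0 (by positivity)]
  linarith [hN n hn.le]

end Ergodic

/-! ### Oscillation in a cone -/

section ConeGeometry

variable {X : Type*} [NormedAddCommGroup X] [NormedSpace ℝ X] {C : Set X}

theorem IsCone.add_mem (hC : IsCone C) {u v : X} (hu : u ∈ C) (hv : v ∈ C) : u + v ∈ C := by
  have h := hC.convex hu hv (a := 1 / 2) (b := 1 / 2) (by norm_num) (by norm_num) (by norm_num)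
  have h2 := hC.smul_mem 2 _ (by norm_num) h
  rw [← smul_add, smul_smul] at h2
  simpa using h2

theorem IsCone.zero_mem (hC : IsCone C) : (0 : X) ∈ C := by
  have : (0 : X) ∈ C ∩ (-C) := by rw [hC.inter_neg]; rfl
  exact this.1

theorem IsCone.eq_zero (hC : IsCone C) {u : X} (hu : u ∈ C) (hu' : -u ∈ C) : u = 0 := by
  have : u ∈ C ∩ (-C) := ⟨hu, hu'⟩
  rwa [hC.inter_neg] at this

theorem IsCone.ne_zero_of_sub_mem (hC : IsCone C) {u e : X} {β : ℝ} (hβ : 0 < β) (he : e ∈ C)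
    (he0 : e ≠ 0) (h : u - β • e ∈ C) : u ≠ 0 := by
  rintro rfl
  rw [zero_sub] at h
  have := hC.eq_zero (hC.smul_mem β e hβ.le he) h
  exact he0 ((smul_eq_zero.1 this).resolve_left hβ.ne')

/-- The norm is monotone on a cone whose order is that of a lattice norm. -/
theorem IsSeparableBanachLattice.norm_le (h : IsSeparableBanachLattice C) {u v : X} (hu : u ∈ C)
    (huv : v - u ∈ C) : ‖u‖ ≤ ‖v‖ := by
  obtain ⟨_, hle, hnorm⟩ := h.lattice
  have hadd : AddLeftMono X := ⟨fun a b c hbc => by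
    rw [hle, ConeLE] at hbc ⊢
    simpa using hbc⟩
  have hu0 : 0 ≤ u := by rw [hle, ConeLE]; simpa using hu
  have huv' : u ≤ v := by rw [hle, ConeLE]; exact huv
  refine hnorm u v ?_
  rwa [abs_of_nonneg hu0, abs_of_nonneg (hu0.trans huv')]

/-- The cone of a Banach lattice is generating: a vector is the difference of its positive and
negative parts. -/
theorem IsSeparableBanachLattice.exists_sub_eq (h : IsSeparableBanachLattice C) (u : X) :
    ∃ p ∈ C, ∃ q ∈ C, u = p - q := by
  obtain ⟨_, hle, -⟩ := h.lattice
  have hadd : AddLeftMono X := ⟨fun a b c hbc => by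
    rw [hle, ConeLE] at hbc ⊢
    simpa using hbc⟩
  have hmem : ∀ v : X, 0 ≤ v → v ∈ C := fun v hv => by
    rw [hle, ConeLE] at hv; simpa using hv
  exact ⟨u⁺, hmem _ (posPart_nonneg u), u⁻, hmem _ (negPart_nonneg u),
    (posPart_sub_negPart u).symm⟩

/-- `u` and `v` are comparable with relative oscillation at most `ε`:
`m v ≤ u ≤ (1 + ε) m v` for some `m > 0`. -/
def IsClose (C : Set X) (ε : ℝ) (u v : X) : Prop :=
  ∃ m : ℝ, 0 < m ∧ u - m • v ∈ C ∧ ((1 + ε) * m) • v - u ∈ C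

theorem IsClose.mono (hC : IsCone C) {ε ε' : ℝ} {u v : X} (hv : v ∈ C) (h : IsClose C ε u v)
    (hε : ε ≤ ε') : IsClose C ε' u v := by
  obtain ⟨m, hm, h1, h2⟩ := h
  refine ⟨m, hm, h1, ?_⟩
  have := hC.add_mem h2 (hC.smul_mem ((ε' - ε) * m) v (by nlinarith) hv)
  convert this using 1
  module

/-- A positive operator does not increase the relative oscillation. -/
theorem IsClose.map {ε : ℝ} {u v : X} (h : IsClose C ε u v) {A : X →L[ℝ] X}
    (hA : ∀ u ∈ C, A u ∈ C) : IsClose C ε (A u) (A v) := by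
  obtain ⟨m, hm, h1, h2⟩ := h
  exact ⟨m, hm, by simpa using hA _ h1, by simpa using hA _ h2⟩

/-- `A` maps every nonzero nonnegative vector into an order interval `[β e, κ β e]`, with `β > 0`
depending on the vector. -/
def FocusesOn (C : Set X) (e : X) (κ : ℝ) (A : X →L[ℝ] X) : Prop :=
  ∀ u ∈ C, u ≠ 0 → ∃ β : ℝ, 0 < β ∧ A u - β • e ∈ C ∧ (κ * β) • e - A u ∈ C

/-- A focusing operator sends any two nonzero nonnegative vectors to comparable ones. -/
theorem FocusesOn.isClose_map (hC : IsCone C) {e : X} {κ : ℝ} (hκ : 1 ≤ κ)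
    {A : X →L[ℝ] X} (hA : FocusesOn C e κ A) {u v : X} (hu : u ∈ C) (hu0 : u ≠ 0) (hv : v ∈ C)
    (hv0 : v ≠ 0) : IsClose C (κ ^ 2 - 1) (A u) (A v) := by
  obtain ⟨a, ha, ha1, ha2⟩ := hA u hu hu0
  obtain ⟨b, hb, hb1, hb2⟩ := hA v hv hv0
  have hκ0 : 0 < κ := by linarith
  refine ⟨a / (κ * b), by positivity, ?_, ?_⟩
  · have := hC.add_mem ha1 (hC.smul_mem (a / (κ * b)) _ (by positivity) hb2)
    convert this using 1
    rw [smul_sub, smul_smul, div_mul_cancel₀ _ (by positivity)]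
    module
  · have := hC.add_mem ha2 (hC.smul_mem (κ * a / b) _ (by positivity) hb1)
    convert this using 1
    rw [smul_sub, smul_smul, div_mul_cancel₀ _ (by positivity)]
    have : (1 + (κ ^ 2 - 1)) * (a / (κ * b)) = κ * a / b := by field_simp; ring
    rw [this]
    module

/-- A focusing operator with constant `κ` contracts the relative oscillation by the factor
`1 - κ⁻²`. -/
theorem FocusesOn.isClose_map_of_isClose (hC : IsCone C) {e : X} (he : e ∈ C) {κ : ℝ}
    (hκ : 1 ≤ κ) {A : X →L[ℝ] X} (hA : FocusesOn C e κ A) {ε : ℝ} (hε : 0 ≤ ε) {u v : X}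
    (hv : v ∈ C) (hv0 : v ≠ 0) (he0 : e ≠ 0) (h : IsClose C ε u v) :
    IsClose C ((1 - (κ ^ 2)⁻¹) * ε) (A u) (A v) := by
  obtain ⟨m, hm, h1, h2⟩ := h
  have hκ0 : 0 < κ := by linarith
  have hA' : ∀ x ∈ C, ∃ β : ℝ, 0 ≤ β ∧ A x - β • e ∈ C ∧ (κ * β) • e - A x ∈ C := by
    intro x hx
    by_cases hx0 : x = 0
    · exact ⟨0, le_rfl, by simpa [hx0] using hC.zero_mem, by simpa [hx0] using hC.zero_mem⟩
    · obtain ⟨β, hβ, h⟩ := hA x hx hx0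
      exact ⟨β, hβ.le, h⟩
  obtain ⟨b, hb, hb1, hb2⟩ := hA v hv hv0
  obtain ⟨p, hp, hp1, hp2⟩ := hA' _ h1
  obtain ⟨q, hq, hq1, hq2⟩ := hA' _ h2
  have hAv : A v ∈ C := by
    have := hC.add_mem hb1 (hC.smul_mem b e hb.le he)
    simpa using this
  -- The two ends of the interval `[m, (1 + ε) m]` move inwards by `p / (κ b)` and `q / (κ b)`;
  -- since `A u - m A v` and `(1 + ε) m A v - A u` add up to `ε m A v`, these are not both small.
  have hsum : ε * m * b ≤ κ * (p + q) := by
    by_contra hlt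
    push Not at hlt
    have h3 := hC.add_mem hp2 hq2
    have h4 := hC.add_mem h3 (hC.smul_mem (ε * m) _ (by positivity) hb1)
    have h5 : (-(ε * m * b - κ * (p + q))) • e ∈ C := by
      convert h4 using 1
      simp only [map_sub, map_smul]
      module
    rw [neg_smul] at h5
    have h6 := hC.eq_zero (hC.smul_mem _ e (sub_pos.2 hlt).le he) h5
    exact he0 ((smul_eq_zero.1 h6).resolve_left (sub_pos.2 hlt).ne')
  have hlow : A u - (m + p / (κ * b)) • A v ∈ C := by
    have := hC.add_mem hp1 (hC.smul_mem (p / (κ * b)) _ (by positivity) hb2)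
    convert this using 1
    rw [smul_sub, smul_smul, div_mul_cancel₀ _ (by positivity)]
    simp only [map_sub, map_smul]
    module
  have hupp : ((1 + ε) * m - q / (κ * b)) • A v - A u ∈ C := by
    have := hC.add_mem hq1 (hC.smul_mem (q / (κ * b)) _ (by positivity) hb2)
    convert this using 1
    rw [smul_sub, smul_smul, div_mul_cancel₀ _ (by positivity)]
    simp only [map_sub, map_smul]
    module
  have hpb : 0 ≤ p / (κ * b) := by positivity
  refine ⟨m + p / (κ * b), by linarith, hlow, ?_⟩
  have hκ2 : 0 ≤ 1 - (κ ^ 2)⁻¹ := by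
    have : (κ ^ 2)⁻¹ ≤ 1 := inv_le_one_of_one_le₀ (one_le_pow₀ hκ)
    linarith
  have hs : ε * m * (κ ^ 2)⁻¹ ≤ p / (κ * b) + q / (κ * b) := by
    rw [← add_div, ← div_eq_mul_inv, div_le_div_iff₀ (by positivity) (by positivity)]
    nlinarith
  have hle : (1 + ε) * m - q / (κ * b) ≤
      (1 + (1 - (κ ^ 2)⁻¹) * ε) * (m + p / (κ * b)) := by
    have : 0 ≤ (1 - (κ ^ 2)⁻¹) * ε * (p / (κ * b)) := by positivity
    nlinarith
  have := hC.add_mem hupp (hC.smul_mem _ _ (sub_nonneg.2 hle) hAv)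
  convert this using 1
  module

/-- The normalization `u / ‖u‖` (with value `0` at `0`). -/
noncomputable def unit (u : X) : X := ‖u‖⁻¹ • u

theorem norm_unit {u : X} (hu : u ≠ 0) : ‖unit u‖ = 1 := by
  rw [unit, norm_smul, norm_inv, norm_norm, inv_mul_cancel₀ (norm_ne_zero_iff.2 hu)]

theorem norm_smul_unit {u : X} (hu : u ≠ 0) : ‖u‖ • unit u = u := by
  rw [unit, smul_smul, mul_inv_cancel₀ (norm_ne_zero_iff.2 hu), one_smul]

theorem unit_smul {a : ℝ} (ha : 0 < a) (u : X) : unit (a • u) = unit u := by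
  rw [unit, unit, norm_smul, Real.norm_of_nonneg ha.le, mul_inv, smul_smul, mul_right_comm,
    inv_mul_cancel₀ ha.ne', one_mul]

theorem IsCone.unit_mem (hC : IsCone C) {u : X} (hu : u ∈ C) : unit u ∈ C :=
  hC.smul_mem _ _ (by positivity) hu

theorem continuousAt_unit {u : X} (hu : u ≠ 0) : ContinuousAt (unit : X → X) u :=
  (continuousAt_id.norm.inv₀ (norm_ne_zero_iff.2 hu)).smul continuousAt_id

/-- For a monotone norm, vectors with small relative oscillation have nearby directions. -/
theorem IsClose.norm_unit_sub_le (hmono : ∀ u v : X, u ∈ C → v - u ∈ C → ‖u‖ ≤ ‖v‖)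
    (hC : IsCone C) {ε : ℝ} {u v : X} (hε : 0 ≤ ε)
    (hv0 : v ≠ 0) (hu0 : u ≠ 0) (h : IsClose C ε u v) : ‖unit u - unit v‖ ≤ 2 * ε := by
  obtain ⟨m, hm, h1, h2⟩ := h
  set x := m⁻¹ • u with hx
  have hxu : unit x = unit u := unit_smul (inv_pos.2 hm) u
  have hx0 : x ≠ 0 := smul_ne_zero (inv_ne_zero hm.ne') hu0
  have hd : ‖x - v‖ ≤ ε * ‖v‖ := by
    have h3 : x - v ∈ C := by
      convert hC.smul_mem m⁻¹ _ (inv_pos.2 hm).le h1 using 1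
      rw [smul_sub, smul_smul, inv_mul_cancel₀ hm.ne', one_smul]
    have h4 : ε • v - (x - v) ∈ C := by
      convert hC.smul_mem m⁻¹ _ (inv_pos.2 hm).le h2 using 1
      have : m⁻¹ * ((1 + ε) * m) = 1 + ε := by field_simp
      rw [smul_sub, smul_smul, this]
      module
    refine (hmono _ _ h3 h4).trans_eq ?_
    rw [norm_smul, Real.norm_of_nonneg hε]
  rw [← hxu]
  have hv : 0 < ‖v‖ := norm_pos_iff.2 hv0
  have hx' : 0 < ‖x‖ := norm_pos_iff.2 hx0
  have hdecomp : unit x - unit v = ‖v‖⁻¹ • (x - v) + (‖v‖⁻¹ * (‖v‖ - ‖x‖)) • unit x := by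
    rw [mul_sub, inv_mul_cancel₀ hv.ne', sub_smul, one_smul, mul_smul, norm_smul_unit hx0]
    simp only [unit]
    module
  rw [hdecomp]
  refine (norm_add_le _ _).trans ?_
  rw [norm_smul, norm_smul, norm_unit hx0, mul_one, norm_mul, norm_inv, norm_norm,
    Real.norm_eq_abs, two_mul]
  have h5 : |‖v‖ - ‖x‖| ≤ ε * ‖v‖ := (abs_norm_sub_norm_le v x).trans (by rwa [norm_sub_rev])
  have h6 : ‖v‖⁻¹ * (ε * ‖v‖) = ε := by field_simp
  exact add_le_add
    ((mul_le_mul_of_nonneg_left hd (inv_pos.2 hv).le).trans_eq h6)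
    ((mul_le_mul_of_nonneg_left h5 (inv_pos.2 hv).le).trans_eq h6)

end ConeGeometry

/-! ### Nonnegative times -/

section Times

variable {k : TimeKind}

/-- The natural number `n` as an element of `𝕋⁺`. -/
def natTime (k : TimeKind) (n : ℕ) : k.TPos := n • k.one

theorem natTime_succ (n : ℕ) : natTime k (n + 1) = natTime k n + k.one := succ_nsmul _ _

theorem natTime_succ' (n : ℕ) : natTime k (n + 1) = k.one + natTime k n := succ_nsmul' _ _

theorem natTime_zero : natTime k 0 = 0 := zero_nsmul _

theorem natTime_one : natTime k 1 = k.one := one_nsmul _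

theorem toReal_add (s t : k.TPos) :
    TimeKind.toReal (s + t) = TimeKind.toReal s + TimeKind.toReal t := rfl

theorem toReal_nonneg (t : k.TPos) : 0 ≤ TimeKind.toReal t := t.2

theorem toReal_le_toReal {s t : k.TPos} : TimeKind.toReal s ≤ TimeKind.toReal t ↔ s ≤ t :=
  Iff.rfl

theorem toReal_injective : Function.Injective (TimeKind.toReal (k := k)) :=
  fun _ _ h => Subtype.ext (Subtype.ext h)

theorem toReal_nsmul (n : ℕ) (t : k.TPos) : TimeKind.toReal (n • t) = n * TimeKind.toReal t := by
  induction n with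
  | zero => rw [zero_nsmul, Nat.cast_zero, zero_mul]; rfl
  | succ n ih => rw [succ_nsmul, toReal_add, ih]; push_cast; ring

theorem toReal_one : TimeKind.toReal k.one = 1 := rfl

theorem toReal_natTime (n : ℕ) : TimeKind.toReal (natTime k n) = n := by
  rw [natTime, toReal_nsmul, toReal_one, mul_one]

theorem toReal_pos {t : k.TPos} (ht : t ≠ 0) : 0 < TimeKind.toReal t :=
  lt_of_le_of_ne (toReal_nonneg t) fun h => ht (toReal_injective h.symm)

theorem exists_add_eq {s t : k.TPos} (h : s ≤ t) : ∃ r, r + s = t :=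
  ⟨⟨(t : k.T) - s, sub_nonneg.2 h⟩, Subtype.ext (sub_add_cancel _ _)⟩

/-- Every time is the sum of its integer part and of its fractional part. -/
theorem exists_natTime_add_eq (t : k.TPos) :
    ∃ s s' : k.TPos, s + natTime k ⌊TimeKind.toReal t⌋₊ = t ∧ s' + s = k.one := by
  obtain ⟨s, hs⟩ := exists_add_eq (s := natTime k ⌊TimeKind.toReal t⌋₊) (t := t) (by
    rw [← toReal_le_toReal, toReal_natTime]
    exact Nat.floor_le (toReal_nonneg t))
  obtain ⟨s', hs'⟩ := exists_add_eq (s := s) (t := k.one) (by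
    rw [← toReal_le_toReal, toReal_one]
    have h := Nat.lt_floor_add_one (TimeKind.toReal t)
    have h2 := congrArg TimeKind.toReal hs
    rw [toReal_add, toReal_natTime] at h2
    linarith)
  exact ⟨s, s', hs, hs'⟩

theorem tendsto_toReal_atTop : Tendsto (TimeKind.toReal (k := k)) atTop atTop := by
  refine tendsto_atTop.2 fun b => ?_
  obtain ⟨n, hn⟩ := exists_nat_ge b
  filter_upwards [eventually_ge_atTop (natTime k n)] with t ht
  rw [← toReal_le_toReal, toReal_natTime] at ht
  exact hn.trans ht

theorem tendsto_atTop_of_toReal {ι : Type*} {l : Filter ι} {f : ι → k.TPos}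
    (h : Tendsto (fun i => TimeKind.toReal (f i)) l atTop) : Tendsto f l atTop :=
  tendsto_atTop.2 fun b => (tendsto_atTop.1 h (TimeKind.toReal b)).mono fun _ hi =>
    toReal_le_toReal.1 hi

theorem tendsto_nsmul_atTop {t : k.TPos} (ht : t ≠ 0) :
    Tendsto (fun n : ℕ => n • t) atTop atTop :=
  tendsto_atTop_of_toReal (by
    simp_rw [toReal_nsmul]
    exact tendsto_natCast_atTop_atTop.atTop_mul_const (toReal_pos ht))

theorem one_ne_zero_time : k.one ≠ 0 := fun h => by
  have := congrArg TimeKind.toReal h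
  rw [toReal_one] at this
  exact one_ne_zero this

theorem tendsto_natTime : Tendsto (natTime k) atTop atTop :=
  tendsto_nsmul_atTop one_ne_zero_time

theorem tendsto_add_right_time (s : k.TPos) : Tendsto (fun t : k.TPos => t + s) atTop atTop :=
  tendsto_atTop_of_toReal (tendsto_atTop_add_const_right _ _ tendsto_toReal_atTop)

end Times

/-! ### Invariant sets and functions -/

section Invariance

variable {Ω : Type*} {k : TimeKind} {θ : k.T → Ω → Ω}

theorem IsInvariantSet.apply_mem {S : Set Ω} (h : IsInvariantSet θ S) (t : k.T) {ω : Ω}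
    (hω : ω ∈ S) : θ t ω ∈ S := by
  rw [← h t]; exact Set.mem_image_of_mem _ hω

variable [MeasurableSpace Ω] {μ : Measure Ω}

theorem IsErgodicMetricDS.neg_apply (hθ : IsErgodicMetricDS μ θ) (t : k.T) (ω : Ω) :
    θ t (θ (-t) ω) = ω := by
  rw [← hθ.map_add, neg_add_cancel, hθ.map_zero]

theorem IsErgodicMetricDS.apply_neg (hθ : IsErgodicMetricDS μ θ) (t : k.T) (ω : Ω) :
    θ (-t) (θ t ω) = ω := by
  rw [← hθ.map_add, add_neg_cancel, hθ.map_zero]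

/-- A set that is mapped into itself at all times, positive and negative, is invariant. -/
theorem IsErgodicMetricDS.isInvariantSet (hθ : IsErgodicMetricDS μ θ) {S : Set Ω}
    (h : ∀ t : k.T, ∀ ω ∈ S, θ t ω ∈ S) : IsInvariantSet θ S := by
  intro t
  refine Set.Subset.antisymm (Set.image_subset_iff.2 (h t)) fun ω hω => ?_
  exact ⟨θ (-t) ω, h _ _ hω, hθ.neg_apply t ω⟩

/-- An invariant property that holds almost everywhere holds on an invariant measurable set of
full measure. In continuous time this uses the completeness of the measure; in discrete time the
translates of a measurable set of full measure are countably many. -/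
theorem IsErgodicMetricDS.exists_invariant_of_ae [IsProbabilityMeasure μ]
    (hθ : IsErgodicMetricDS μ θ) (hc : k = .continuous → μ.IsComplete) {P : Ω → Prop}
    (hP : ∀ (t : k.T) (ω : Ω), P ω → P (θ t ω)) (hae : ∀ᵐ ω ∂μ, P ω) :
    ∃ S : Set Ω, MeasurableSet S ∧ IsInvariantSet θ S ∧ μ S = 1 ∧ ∀ ω ∈ S, P ω := by
  cases k with
  | continuous =>
    have := hc rfl
    have hm : MeasurableSet {ω | P ω} := by
      rw [← MeasurableSet.compl_iff]
      exact Measure.IsComplete.out' _ hae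
    refine ⟨{ω | P ω}, hm, hθ.isInvariantSet hP, ?_, fun ω hω => hω⟩
    rwa [← mem_ae_iff_prob_eq_one hm]
  | discrete =>
    obtain ⟨M, hMP, hM, hμM⟩ := exists_measurable_superset_of_null hae
    have hcount : Countable TimeKind.discrete.T := by
      have : (Set.range (Int.castAddHom ℝ)).Countable := Set.countable_range _
      exact this.to_subtype
    set S : Set Ω := ⋂ t : TimeKind.discrete.T, θ t ⁻¹' Mᶜ with hS
    have hSm : MeasurableSet S :=
      MeasurableSet.iInter fun t => (hθ.preserving t).measurable hM.compl
    refine ⟨S, hSm, hθ.isInvariantSet fun t ω hω => ?_, ?_, fun ω hω => ?_⟩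
    · refine Set.mem_iInter.2 fun s => ?_
      have := Set.mem_iInter.1 hω (t + s)
      rwa [Set.mem_preimage, hθ.map_add] at this
    · rw [← mem_ae_iff_prob_eq_one hSm, hS, countable_iInter_mem]
      intro t
      exact (hθ.preserving t).quasiMeasurePreserving.ae (compl_mem_ae_iff.2 hμM)
    · have := Set.mem_iInter.1 hω 0
      rw [Set.mem_preimage, hθ.map_zero] at this
      by_contra hne
      exact this (hMP hne)

/-- By ergodicity an invariant measurable function, defined on an invariant set of full measure,
is constant on a smaller such set. -/
theorem IsErgodicMetricDS.exists_const [IsProbabilityMeasure μ] (hθ : IsErgodicMetricDS μ θ)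
    {S : Set Ω} (hS : MeasurableSet S) (hSi : IsInvariantSet θ S) (hS1 : μ S = 1)
    {f : Ω → EReal} (hf : Measurable f) (hfi : ∀ (t : k.T), ∀ ω ∈ S, f (θ t ω) = f ω) :
    ∃ c, MeasurableSet (S ∩ f ⁻¹' {c}) ∧ IsInvariantSet θ (S ∩ f ⁻¹' {c}) ∧
      μ (S ∩ f ⁻¹' {c}) = 1 := by
  have hinv : ∀ V : Set EReal, IsInvariantSet θ (S ∩ f ⁻¹' V) := fun V =>
    hθ.isInvariantSet fun t ω hω => ⟨hSi.apply_mem t hω.1, by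
      rw [Set.mem_preimage, hfi t ω hω.1]; exact hω.2⟩
  have hSae : ∀ᵐ ω ∂μ, ω ∈ S := (mem_ae_iff_prob_eq_one hS).2 hS1
  obtain ⟨c, hc⟩ := Filter.exists_eventuallyEq_const_of_forall_separating (l := ae μ) (f := f)
    MeasurableSet (by
      intro V hV
      have hm := hS.inter (hf hV)
      rcases hθ.ergodic _ hm (hinv V) with h | h
      · refine Or.inl ?_
        filter_upwards [(mem_ae_iff_prob_eq_one hm).2 h] with ω hω
        exact hω.2
      · refine Or.inr ?_
        filter_upwards [measure_eq_zero_iff_ae_notMem.1 h, hSae] with ω h1 h2 h3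
        exact h1 ⟨h2, h3⟩)
  have hm : MeasurableSet (S ∩ f ⁻¹' {c}) := hS.inter (hf (measurableSet_singleton c))
  refine ⟨c, hm, hinv _, (mem_ae_iff_prob_eq_one hm).1 ?_⟩
  filter_upwards [hc, hSae] with ω h1 h2
  exact ⟨h2, h1⟩

end Invariance

/-! ### Equivariant positive directions -/

section Directions

variable {Ω : Type*} [MeasurableSpace Ω] {k : TimeKind} {μ : Measure Ω} {θ : k.T → Ω → Ω}
  {X : Type*} [NormedAddCommGroup X] [NormedSpace ℝ X] [MeasurableSpace X]
  {U : k.TPos → Ω → X →L[ℝ] X} {C : Set X} {e : X} {κ : Ω → ℝ}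

theorem IsMLSPS.cocycle_apply (hU : IsMLSPS θ U) (ω : Ω) (t s : k.TPos) (u : X) :
    U t (θ (s : k.T) ω) (U s ω u) = U (t + s) ω u := by
  rw [← hU.cocycle]; rfl

theorem Positivity.map_mem (hP : Positivity μ θ U C) (t : k.TPos) (ω : Ω) {u : X} (hu : u ∈ C) :
    U t ω u ∈ C := by
  have := hP.monotone ω t 0 u (by simpa [ConeLE] using hu)
  simpa [ConeLE] using this

theorem Focusing.e_ne_zero (hF : Focusing μ θ U C e κ) : e ≠ 0 := by
  rintro rfl
  simpa using hF.norm_e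

theorem Focusing.focusesOn (hF : Focusing μ θ U C e κ) (ω : Ω) :
    FocusesOn C e (κ ω) (U k.one ω) :=
  fun u hu hu0 => hF.focusing ω u hu hu0

theorem Focusing.map_ne_zero (hF : Focusing μ θ U C e κ) (t : k.TPos) (ω : Ω) {u : X}
    (hu : u ∈ C) (hu0 : u ≠ 0) : U t ω u ≠ 0 := by
  have hC := hF.positivity.space.cone
  have hnat : ∀ n, U (natTime k n) ω u ≠ 0 := by
    intro n
    induction n with
    | zero => rw [natTime_zero, hF.positivity.system.map_zero]; exact hu0
    | succ n ih =>
      rw [natTime_succ', ← hF.positivity.system.cocycle_apply]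
      obtain ⟨β, hβ, h, -⟩ := hF.focusing (θ (natTime k n : k.T) ω) _
        (hF.positivity.map_mem _ ω hu) ih
      exact hC.ne_zero_of_sub_mem hβ hF.e_mem hF.e_ne_zero h
  intro h0
  obtain ⟨n, hn⟩ := (tendsto_natTime.eventually_ge_atTop t).exists
  obtain ⟨r, hr⟩ := exists_add_eq hn
  refine hnat n ?_
  rw [← hr, ← hF.positivity.system.cocycle_apply, h0, map_zero]

/-- `U_{θ_{-t-s} ω}(t + s)` factors through time `-t`. -/
theorem IsMLSPS.pullback_add (hU : IsMLSPS θ U) (hθ : IsErgodicMetricDS μ θ) (ω : Ω)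
    (t s : k.TPos) (u : X) :
    U (t + s) (θ (-((t + s : k.TPos) : k.T)) ω) u =
      U t (θ (-(t : k.T)) ω) (U s (θ (-((t + s : k.TPos) : k.T)) ω) u) := by
  have h : θ (-(t : k.T)) ω = θ (s : k.T) (θ (-((t + s : k.TPos) : k.T)) ω) := by
    rw [← hθ.map_add]
    congr 1
    rw [Nonneg.coe_add]
    abel
  rw [h, hU.cocycle_apply]

/-- The images of the cone at `ω` under the evolution from the remote past have arbitrarily small
projective diameter. -/
def IsContracting (θ : k.T → Ω → Ω) (U : k.TPos → Ω → X →L[ℝ] X) (C : Set X) (ω : Ω) : Prop :=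
  ∀ ε : ℝ, 0 < ε → ∃ t : k.TPos, ∀ u ∈ C, u ≠ 0 → ∀ v ∈ C, v ≠ 0 →
    IsClose C ε (U t (θ (-(t : k.T)) ω) u) (U t (θ (-(t : k.T)) ω) v)

theorem iterate_neg_one (hθ : IsErgodicMetricDS μ θ) (n : ℕ) (ω : Ω) :
    (θ (-(k.one : k.T)))^[n] ω = θ (-(natTime k n : k.T)) ω := by
  induction n generalizing ω with
  | zero => rw [natTime_zero, Nonneg.coe_zero, neg_zero, hθ.map_zero]; rfl
  | succ n ih =>
    rw [Function.iterate_succ_apply, ih, ← hθ.map_add, natTime_succ, Nonneg.coe_add]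
    congr 1
    abel

theorem iterate_one (hθ : IsErgodicMetricDS μ θ) (n : ℕ) (ω : Ω) :
    (θ (k.one : k.T))^[n] ω = θ (natTime k n : k.T) ω := by
  induction n generalizing ω with
  | zero => rw [natTime_zero, Nonneg.coe_zero, hθ.map_zero]; rfl
  | succ n ih =>
    rw [Function.iterate_succ_apply, ih, ← hθ.map_add, natTime_succ', Nonneg.coe_add]

/-- The oscillation of two vectors transported from time `-(N + 1)`: the earliest time step makes it
finite, and the remaining `N` steps contract it. -/
theorem Focusing.isClose_pullback (hF : Focusing μ θ U C e κ) (N : ℕ) (ω : Ω) {u v : X}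
    (hu : u ∈ C) (hu0 : u ≠ 0) (hv : v ∈ C) (hv0 : v ≠ 0) :
    IsClose C ((∏ j ∈ Finset.range N, (1 - (κ ((θ (-(k.one : k.T)))^[j + 1] ω) ^ 2)⁻¹)) *
        (κ ((θ (-(k.one : k.T)))^[N + 1] ω) ^ 2 - 1))
      (U (natTime k (N + 1)) ((θ (-(k.one : k.T)))^[N + 1] ω) u)
      (U (natTime k (N + 1)) ((θ (-(k.one : k.T)))^[N + 1] ω) v) := by
  have hC := hF.positivity.space.cone
  have hθ := hF.positivity.base
  induction N generalizing ω with
  | zero =>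
    simp only [Finset.range_zero, Finset.prod_empty, one_mul, zero_add, natTime_one]
    exact (hF.focusesOn _).isClose_map hC (hF.one_le _) hu hu0 hv hv0
  | succ N ih =>
    set S := θ (-(k.one : k.T)) with hS
    have hfac : ∀ x : X, U (natTime k (N + 1 + 1)) (S^[N + 1 + 1] ω) x =
        U k.one (S ω) (U (natTime k (N + 1)) (S^[N + 1] (S ω)) x) := by
      intro x
      have h : θ (natTime k (N + 1) : k.T) (S^[N + 1] (S ω)) = S ω := by
        rw [hS, iterate_neg_one hθ, hθ.neg_apply]
      have h2 := hF.positivity.system.cocycle_apply (S^[N + 1] (S ω)) k.one (natTime k (N + 1)) x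
      rw [h, ← natTime_succ'] at h2
      rw [h2, Function.iterate_succ_apply]
    rw [hfac, hfac, Finset.prod_range_succ', mul_comm (Finset.prod _ _), mul_assoc]
    refine (hF.focusesOn (S ω)).isClose_map_of_isClose hC hF.e_mem (hF.one_le _) ?_
      (hF.positivity.map_mem _ _ hv) (hF.map_ne_zero _ _ hv hv0) hF.e_ne_zero (ih (S ω))
    have hnn : ∀ x : Ω, 0 ≤ 1 - (κ x ^ 2)⁻¹ := fun x =>
      sub_nonneg.2 (inv_le_one_of_one_le₀ (one_le_pow₀ (hF.one_le x)))
    exact mul_nonneg (Finset.prod_nonneg fun j _ => hnn _)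
      (sub_nonneg.2 (one_le_pow₀ (hF.one_le _)))

/-- By Poincaré recurrence of the sets `{κ ≤ K}` under `θ_{-1}`, the contraction factors along
almost every backward orbit have product `0`. -/
theorem Focusing.ae_isContracting [IsProbabilityMeasure μ] (hF : Focusing μ θ U C e κ) :
    ∀ᵐ ω ∂μ, IsContracting θ U C ω := by
  have hθ := hF.positivity.base
  have hC := hF.positivity.space.cone
  set S := θ (-(k.one : k.T)) with hS
  have hSmp : MeasurePreserving S μ μ := hθ.preserving _
  have hrec : ∀ K : ℕ, ∀ᵐ ω ∂μ, κ ω ≤ K → ∃ᶠ n in atTop, κ (S^[n] ω) ≤ K := fun K =>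
    hSmp.conservative.ae_mem_imp_frequently_image_mem (s := {ω | κ ω ≤ K})
      (measurableSet_le hF.measurable measurable_const).nullMeasurableSet
  filter_upwards [ae_all_iff.2 hrec] with ω hω
  obtain ⟨K, hK⟩ := exists_nat_ge (κ ω)
  have hfr : ∃ᶠ n in atTop, κ (S^[n + 1] ω) ≤ K := by
    have := hω K hK
    rw [← map_add_atTop_eq_nat 1, frequently_map] at this
    exact this
  have hK1 : (1 : ℝ) ≤ K := (hF.one_le ω).trans hK
  set c : ℕ → ℝ := fun j => 1 - (κ (S^[j + 1] ω) ^ 2)⁻¹ with hc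
  have hc0 : ∀ j, 0 ≤ c j := fun j =>
    sub_nonneg.2 (inv_le_one_of_one_le₀ (one_le_pow₀ (hF.one_le _)))
  have hc1 : ∀ j, c j ≤ 1 := fun j => sub_le_self _ (by positivity)
  set p : ℕ → ℝ := fun N => ∏ j ∈ Finset.range N, c j with hp
  have hp0 : ∀ N, 0 ≤ p N := fun N => Finset.prod_nonneg fun j _ => hc0 j
  have hps : ∀ N, p (N + 1) = p N * c N := fun N => Finset.prod_range_succ _ _
  have hanti : Antitone p := antitone_nat_of_succ_le fun N => by
    rw [hps]; exact mul_le_of_le_one_right (hp0 N) (hc1 N)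
  have hlim : Tendsto p atTop (𝓝 (⨅ N, p N)) :=
    tendsto_atTop_ciInf hanti ⟨0, by rintro _ ⟨N, rfl⟩; exact hp0 N⟩
  set l := ⨅ N, p N with hl
  have hl0 : 0 ≤ l := ge_of_tendsto' hlim hp0
  -- At each visit the product shrinks at least by the fixed factor `1 - K⁻²`.
  have hlz : l = 0 := by
    have h1 : Tendsto (fun N => p (N + 1) - p N * (1 - ((K : ℝ) ^ 2)⁻¹)) atTop
        (𝓝 (l - l * (1 - ((K : ℝ) ^ 2)⁻¹))) :=
      ((tendsto_add_atTop_iff_nat 1).2 hlim).sub (hlim.mul_const _)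
    have h2 : l - l * (1 - ((K : ℝ) ^ 2)⁻¹) ≤ 0 := by
      refine le_of_tendsto_of_frequently h1 (hfr.mono fun N hN => ?_)
      rw [hps, sub_nonpos]
      refine mul_le_mul_of_nonneg_left (sub_le_sub_left ?_ _) (hp0 N)
      have := hF.one_le (S^[N + 1] ω)
      gcongr
    have h3 : 0 < ((K : ℝ) ^ 2)⁻¹ := by positivity
    nlinarith
  rw [hlz] at hlim
  intro ε hε
  have hev : ∀ᶠ N in atTop, p N < ε / (K : ℝ) ^ 2 :=
    hlim.eventually (gt_mem_nhds (by positivity))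
  obtain ⟨N, hN1, hN2⟩ := (hfr.and_eventually hev).exists
  refine ⟨natTime k (N + 1), fun u hu hu0 v hv hv0 => ?_⟩
  have h := hF.isClose_pullback N ω hu hu0 hv hv0
  rw [← iterate_neg_one hθ]
  refine h.mono hC (hF.positivity.map_mem _ _ hv) ?_
  have hκ := hF.one_le (S^[N + 1] ω)
  rw [lt_div_iff₀ (by positivity)] at hN2
  refine le_trans (mul_le_mul_of_nonneg_left ?_ (hp0 N)) hN2.le
  have : κ (S^[N + 1] ω) ^ 2 ≤ (K : ℝ) ^ 2 := by gcongr
  linarith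

/-- Contraction at `ω` persists along the forward orbit of `ω`. -/
theorem IsContracting.forward (hP : Positivity μ θ U C) {ω : Ω} (h : IsContracting θ U C ω)
    (s : k.TPos) : IsContracting θ U C (θ (s : k.T) ω) := by
  intro ε hε
  obtain ⟨t, ht⟩ := h ε hε
  refine ⟨s + t, fun u hu hu0 v hv hv0 => ?_⟩
  have hx : ∀ x : X, U (s + t) (θ (-((s + t : k.TPos) : k.T)) (θ (s : k.T) ω)) x =
      U s ω (U t (θ (-(t : k.T)) ω) x) := by
    intro x
    have h1 : θ (-((s + t : k.TPos) : k.T)) (θ (s : k.T) ω) = θ (-(t : k.T)) ω := by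
      rw [← hP.base.map_add, Nonneg.coe_add]
      congr 1
      abel
    rw [h1, ← hP.system.cocycle_apply, hP.base.neg_apply]
  rw [hx, hx]
  exact (ht u hu hu0 v hv hv0).map fun x hx => hP.map_mem _ _ hx

/-- At a point of contraction all directions transported from the remote past converge to the
same direction. -/
theorem IsContracting.exists_direction [CompleteSpace X] (hL : IsSeparableBanachLattice C)
    (hF : Focusing μ θ U C e κ) {ω : Ω} (h : IsContracting θ U C ω) :
    ∃ w ∈ C, ‖w‖ = 1 ∧ ∀ v : k.TPos → X, (∀ t, v t ∈ C ∧ v t ≠ 0) →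
      Tendsto (fun t : k.TPos => unit (U t (θ (-(t : k.T)) ω) (v t))) atTop (𝓝 w) := by
  have hC := hL.cone
  have hsys := hF.positivity.system
  have hθ := hF.positivity.base
  have key : ∀ δ : ℝ, 0 < δ → ∃ t : k.TPos, ∀ s, t ≤ s → ∀ s', t ≤ s' → ∀ u ∈ C, u ≠ 0 →
      ∀ v ∈ C, v ≠ 0 → dist (unit (U s (θ (-(s : k.T)) ω) u))
        (unit (U s' (θ (-(s' : k.T)) ω) v)) ≤ δ := by
    intro δ hδ
    obtain ⟨t, ht⟩ := h (δ / 2) (by positivity)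
    refine ⟨t, fun s hs s' hs' u hu hu0 v hv hv0 => ?_⟩
    obtain ⟨r, hr⟩ := exists_add_eq hs
    obtain ⟨r', hr'⟩ := exists_add_eq hs'
    rw [add_comm] at hr hr'
    subst hr hr'
    rw [hsys.pullback_add hθ, hsys.pullback_add hθ, dist_eq_norm]
    have hu' := hF.positivity.map_mem r (θ (-((t + r : k.TPos) : k.T)) ω) hu
    have hu0' := hF.map_ne_zero r (θ (-((t + r : k.TPos) : k.T)) ω) hu hu0
    have hv' := hF.positivity.map_mem r' (θ (-((t + r' : k.TPos) : k.T)) ω) hv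
    have hv0' := hF.map_ne_zero r' (θ (-((t + r' : k.TPos) : k.T)) ω) hv hv0
    refine ((ht _ hu' hu0' _ hv' hv0').norm_unit_sub_le (fun _ _ => hL.norm_le) hC
      (by positivity) (hF.map_ne_zero _ _ hv' hv0') (hF.map_ne_zero _ _ hu' hu0')).trans_eq ?_
    ring
  have hcauchy : CauchySeq fun t : k.TPos => unit (U t (θ (-(t : k.T)) ω) e) := by
    refine Metric.cauchySeq_iff.2 fun δ hδ => ?_
    obtain ⟨t, ht⟩ := key (δ / 2) (by positivity)
    exact ⟨t, fun s hs s' hs' => (ht s hs s' hs' e hF.e_mem hF.e_ne_zero e hF.e_mem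
      hF.e_ne_zero).trans_lt (by linarith)⟩
  obtain ⟨w, hw⟩ := cauchySeq_tendsto_of_complete hcauchy
  refine ⟨w, hC.isClosed.mem_of_tendsto hw (Eventually.of_forall fun t =>
    hC.unit_mem (hF.positivity.map_mem _ _ hF.e_mem)), ?_, fun v hv => ?_⟩
  · refine tendsto_nhds_unique hw.norm ?_
    simp_rw [fun t : k.TPos => norm_unit (hF.map_ne_zero t (θ (-(t : k.T)) ω) hF.e_mem
      hF.e_ne_zero)]
    exact tendsto_const_nhds
  · refine tendsto_of_tendsto_of_dist hw (Metric.tendsto_atTop.2 fun δ hδ => ?_)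
    obtain ⟨t, ht⟩ := key (δ / 2) (by positivity)
    refine ⟨t, fun s hs => ?_⟩
    rw [Real.dist_0_eq_abs, abs_of_nonneg dist_nonneg]
    exact (ht s hs s hs e hF.e_mem hF.e_ne_zero _ (hv s).1 (hv s).2).trans_lt (by linarith)

/-- The equivariant measurable field of positive directions. -/
theorem Focusing.exists_equivariant_direction [IsProbabilityMeasure μ] [CompleteSpace X]
    [BorelSpace X] (hL : IsSeparableBanachLattice C) (hF : Focusing μ θ U C e κ)
    (hc : k = .continuous → μ.IsComplete) :
    ∃ (S : Set Ω) (w : Ω → X), MeasurableSet S ∧ IsInvariantSet θ S ∧ μ S = 1 ∧ Measurable w ∧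
      ∀ ω ∈ S, w ω ∈ C ∧ ‖w ω‖ = 1 ∧ ∀ t : k.TPos, unit (U t ω (w ω)) = w (θ (t : k.T) ω) := by
  have hθ := hF.positivity.base
  have hsys := hF.positivity.system
  have := hL.separable
  have : SecondCountableTopology X := UniformSpace.secondCountable_of_separable X
  have hae : ∀ᵐ ω ∂μ, ∀ t : k.T, IsContracting θ U C (θ t ω) := by
    have h1 : ∀ n : ℕ, ∀ᵐ ω ∂μ, IsContracting θ U C (θ (-(natTime k n : k.T)) ω) := fun n =>
      (hθ.preserving _).quasiMeasurePreserving.ae hF.ae_isContracting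
    filter_upwards [ae_all_iff.2 h1] with ω hω t
    obtain ⟨n, hn⟩ := (tendsto_natTime.eventually_ge_atTop
      (⟨|t|, abs_nonneg t⟩ : k.TPos)).exists
    have hnt : 0 ≤ (natTime k n : k.T) + t := by
      have h2 : |t| ≤ (natTime k n : k.T) := hn
      rw [← neg_le_iff_add_nonneg]
      exact (neg_le_abs t).trans h2
    have h4 := (hω n).forward hF.positivity ⟨_, hnt⟩
    rw [← hθ.map_add] at h4
    simpa using h4
  obtain ⟨S, hS, hSi, hS1, hSP⟩ := hθ.exists_invariant_of_ae hc
    (P := fun ω => ∀ t : k.T, IsContracting θ U C (θ t ω))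
    (fun t ω h s => by rw [← hθ.map_add]; exact h _) hae
  have hdir : ∀ ω ∈ S, IsContracting θ U C ω := fun ω hω => by
    have := hSP ω hω 0
    rwa [hθ.map_zero] at this
  choose! w hwC hw1 hw using fun ω (hω : ω ∈ S) => (hdir ω hω).exists_direction hL hF
  refine ⟨S, S.indicator w, hS, hSi, hS1, ?_, fun ω hω => ?_⟩
  · refine measurable_of_tendsto_metrizable (f := fun (n : ℕ) => S.indicator fun ω =>
      unit (U (natTime k n) (θ (-(natTime k n : k.T)) ω) e)) (fun n => ?_) ?_
    · have h1 : Measurable fun ω => U (natTime k n) (θ (-(natTime k n : k.T)) ω) e :=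
        hsys.measurable.comp (measurable_const.prodMk
          ((hθ.preserving _).measurable.prodMk measurable_const))
      exact Measurable.indicator (h1.norm.inv.smul h1) hS
    · refine tendsto_pi_nhds.2 fun ω => ?_
      by_cases hω : ω ∈ S
      · simp only [Set.indicator_of_mem hω]
        exact (hw ω hω (fun _ => e) fun _ => ⟨hF.e_mem, hF.e_ne_zero⟩).comp tendsto_natTime
      · simp only [Set.indicator_of_notMem hω]
        exact tendsto_const_nhds
  · simp only [Set.indicator_of_mem hω, Set.indicator_of_mem (hSi.apply_mem _ hω)]
    refine ⟨hwC ω hω, hw1 ω hω, fun s => ?_⟩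
    have hw0 : w ω ≠ 0 := fun h0 => by simpa [h0] using hw1 ω hω
    have h1 := hw ω hω (fun _ => e) fun _ => ⟨hF.e_mem, hF.e_ne_zero⟩
    have h2 := (hw _ (hSi.apply_mem (s : k.T) hω) (fun _ => e)
      fun _ => ⟨hF.e_mem, hF.e_ne_zero⟩).comp (tendsto_add_right_time s)
    have h3 := ((continuousAt_unit (hF.map_ne_zero s ω (hwC ω hω) hw0)).tendsto.comp
      ((U s ω).continuous.tendsto _)).comp h1
    refine tendsto_nhds_unique h3 (h2.congr fun t => ?_)
    simp only [Function.comp_apply]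
    have h4 : θ (-((t + s : k.TPos) : k.T)) (θ (s : k.T) ω) = θ (-(t : k.T)) ω := by
      rw [← hθ.map_add, Nonneg.coe_add]
      congr 1
      abel
    have hne := hF.map_ne_zero t (θ (-(t : k.T)) ω) hF.e_mem hF.e_ne_zero
    rw [h4, add_comm t s, ← hsys.cocycle_apply, hθ.neg_apply,
      unit.eq_def (U t (θ (-(t : k.T)) ω) e), map_smul,
      unit_smul (inv_pos.2 (norm_pos_iff.2 hne))]

end Directions

/-! ### Growth rates -/

section Growth

/-- Perturbing a real family by an infinitesimal summand and a factor tending to `1` does not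
affect its limit in `[-∞, ∞]`. -/
theorem tendsto_coe_mul_add {ι : Type*} {l : Filter ι} {x c d : ι → ℝ} {L : EReal}
    (hx : Tendsto (fun i => (x i : EReal)) l (𝓝 L)) (hc : Tendsto c l (𝓝 1))
    (hd : Tendsto d l (𝓝 0)) :
    Tendsto (fun i => ((c i * (x i + d i) : ℝ) : EReal)) l (𝓝 L) := by
  have hc' : Tendsto (fun i => (c i : EReal)) l (𝓝 ((1 : ℝ) : EReal)) := EReal.tendsto_coe.2 hc
  have hd' : Tendsto (fun i => (d i : EReal)) l (𝓝 ((0 : ℝ) : EReal)) := EReal.tendsto_coe.2 hd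
  have hadd : Tendsto (fun i => (x i : EReal) + (d i : EReal)) l (𝓝 (L + ((0 : ℝ) : EReal))) :=
    (EReal.continuousAt_add (p := (L, ((0 : ℝ) : EReal))) (Or.inr (EReal.coe_ne_bot _))
      (Or.inr (EReal.coe_ne_top _))).tendsto.comp (hx.prodMk_nhds hd')
  have hmul := (EReal.continuousAt_mul (p := (((1 : ℝ) : EReal), L + ((0 : ℝ) : EReal)))
    (Or.inl (by simp)) (Or.inl (by simp)) (Or.inl (EReal.coe_ne_bot _))
    (Or.inl (EReal.coe_ne_top _))).tendsto.comp (hc'.prodMk_nhds hadd)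
  simp only [EReal.coe_one, EReal.coe_zero, add_zero, one_mul] at hmul
  refine hmul.congr fun i => ?_
  simp only [Function.comp_apply]
  rw [EReal.coe_mul, EReal.coe_add]

theorem log_enorm {X : Type*} [NormedAddCommGroup X] {u : X} (hu : u ≠ 0) :
    ENNReal.log ‖u‖ₑ = ((Real.log ‖u‖ : ℝ) : EReal) := by
  rw [← ofReal_norm, ENNReal.log_ofReal_of_pos (norm_pos_iff.2 hu)]

variable {Ω : Type*} {k : TimeKind} {X : Type*} [NormedAddCommGroup X] [NormedSpace ℝ X]
  {U : k.TPos → Ω → X →L[ℝ] X}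

theorem growthRate_eq {ω : Ω} {u : X} {t : k.TPos} (h : U t ω u ≠ 0) :
    growthRate U ω u t = ((Real.log ‖U t ω u‖ / TimeKind.toReal t : ℝ) : EReal) := by
  rw [growthRate, log_enorm h, ← EReal.coe_mul, one_div_mul_eq_div]

theorem growthRate_mono {ω : Ω} {u : X} {t : k.TPos} {c : ℝ} (hc : 0 < c)
    (h : ‖U t ω u‖ ≤ c) :
    growthRate U ω u t ≤ ((Real.log c / TimeKind.toReal t : ℝ) : EReal) := by
  rw [growthRate, ← one_div_mul_eq_div (TimeKind.toReal t) (Real.log c), EReal.coe_mul]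
  refine mul_le_mul_of_nonneg_left ?_
    (EReal.coe_nonneg.2 (one_div_nonneg.2 (toReal_nonneg t)))
  rw [← ENNReal.log_ofReal_of_pos hc, ← ofReal_norm]
  exact ENNReal.log_monotone (ENNReal.ofReal_le_ofReal h)

theorem tendsto_const_div_time (a : ℝ) :
    Tendsto (fun t : k.TPos => a / TimeKind.toReal t) atTop (𝓝 0) :=
  tendsto_const_nhds.div_atTop tendsto_toReal_atTop

theorem eventually_toReal_pos : ∀ᶠ t : k.TPos in atTop, 0 < TimeKind.toReal t :=
  tendsto_toReal_atTop.eventually_gt_atTop 0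

theorem exists_shift (s : k.TPos) : ∃ ρ : k.TPos → k.TPos, Tendsto ρ atTop atTop ∧
    ∀ t, s ≤ t → ρ t + s = t := by
  have h : ∀ t : k.TPos, ∃ r, s ≤ t → r + s = t := fun t => by
    by_cases hst : s ≤ t
    · obtain ⟨r, hr⟩ := exists_add_eq hst
      exact ⟨r, fun _ => hr⟩
    · exact ⟨0, fun h => absurd h hst⟩
  choose ρ hρ using h
  refine ⟨ρ, tendsto_atTop_of_toReal ?_, hρ⟩
  refine (tendsto_atTop_add_const_right atTop (-TimeKind.toReal s) tendsto_toReal_atTop).congr' ?_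
  filter_upwards [eventually_ge_atTop s] with t ht
  have := congrArg TimeKind.toReal (hρ t ht)
  rw [toReal_add] at this
  linarith

theorem log_norm_apply_le {A : X →L[ℝ] X} {u : X} (hu : u ≠ 0) (hAu : A u ≠ 0) :
    Real.log ‖A u‖ ≤ Real.posLog ‖A‖ + Real.log ‖u‖ := by
  have h1 : 0 < ‖u‖ := norm_pos_iff.2 hu
  have h2 : 0 < ‖A u‖ := norm_pos_iff.2 hAu
  have h3 := A.le_opNorm u
  have h4 : 0 < ‖A‖ := pos_of_mul_pos_left (h2.trans_le h3) h1.le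
  calc Real.log ‖A u‖ ≤ Real.log (‖A‖ * ‖u‖) := Real.log_le_log h2 h3
    _ = Real.log ‖A‖ + Real.log ‖u‖ := Real.log_mul h4.ne' h1.ne'
    _ ≤ _ := by gcongr; exact le_max_right _ _

variable {θ : k.T → Ω → Ω}

/-- The growth rates along two orbits that merge up to a scalar agree. -/
theorem tendsto_growthRate_shift_iff {ω ω' : Ω} {s : k.TPos} {u u' : X} {a : ℝ} (ha : 0 < a)
    (hne : ∀ t, U t ω u ≠ 0) (hne' : ∀ t, U t ω' u' ≠ 0)
    (h : ∀ t, U (t + s) ω u = a • U t ω' u') (L : EReal) :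
    Tendsto (growthRate U ω u) atTop (𝓝 L) ↔ Tendsto (growthRate U ω' u') atTop (𝓝 L) := by
  have hlog : ∀ t, Real.log ‖U (t + s) ω u‖ = Real.log a + Real.log ‖U t ω' u'‖ := fun t => by
    rw [h, norm_smul, Real.norm_of_nonneg ha.le,
      Real.log_mul ha.ne' (norm_ne_zero_iff.2 (hne' t))]
  rw [show growthRate U ω u = _ from funext fun t => growthRate_eq (hne t),
    show growthRate U ω' u' = _ from funext fun t => growthRate_eq (hne' t)]
  have hadd : Tendsto (fun t : k.TPos => t + s) atTop atTop := tendsto_add_right_time s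
  -- the ratio of the two time scales
  have hc : Tendsto (fun t : k.TPos => TimeKind.toReal (t + s) / TimeKind.toReal t) atTop
      (𝓝 1) := by
    have h1 : Tendsto (fun t : k.TPos => 1 + TimeKind.toReal s / TimeKind.toReal t) atTop
        (𝓝 (1 + 0)) := tendsto_const_nhds.add (tendsto_const_div_time _)
    rw [add_zero] at h1
    refine h1.congr' ?_
    filter_upwards [eventually_toReal_pos] with t ht
    rw [toReal_add, add_div, div_self ht.ne']
  constructor
  · intro hL
    have h1 := tendsto_coe_mul_add (hL.comp hadd) hc
      ((tendsto_const_div_time (-Real.log a)).comp hadd)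
    refine h1.congr' ?_
    filter_upwards [eventually_toReal_pos] with t ht
    have ht' : 0 < TimeKind.toReal (t + s) := by
      rw [toReal_add]; exact add_pos_of_pos_of_nonneg ht (toReal_nonneg s)
    simp only [Function.comp_apply, hlog]
    congr 1
    field_simp
    ring
  · intro hL
    obtain ⟨ρ, hρ, hρs⟩ := exists_shift s
    have hc' := hc.inv₀ one_ne_zero
    rw [inv_one] at hc'
    have h1 := (tendsto_coe_mul_add hL hc' (tendsto_const_div_time (Real.log a))).comp hρ
    refine h1.congr' ?_
    filter_upwards [eventually_ge_atTop s, hρ.eventually eventually_toReal_pos] with t ht hpos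
    have ht' : 0 < TimeKind.toReal (ρ t + s) := by
      rw [toReal_add]; exact add_pos_of_pos_of_nonneg hpos (toReal_nonneg s)
    simp only [Function.comp_apply]
    have h2 := hlog (ρ t)
    have h3 := hρs t ht
    rw [h3] at h2 ht' ⊢
    rw [h2]
    congr 1
    field_simp
    ring

variable [MeasurableSpace Ω] {μ : Measure Ω} [MeasurableSpace X]

theorem time_eq_zero_or_one {s s' : TimeKind.discrete.TPos} (h : s + s' = TimeKind.discrete.one) :
    s = 0 ∧ s' = TimeKind.discrete.one ∨ s = TimeKind.discrete.one ∧ s' = 0 := by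
  have key : s = 0 ∨ s' = 0 := by
    obtain ⟨n, hn⟩ := (s : TimeKind.discrete.T).2
    obtain ⟨m, hm⟩ := (s' : TimeKind.discrete.T).2
    have h1 := congrArg TimeKind.toReal h
    have h2 := toReal_nonneg s
    have h3 := toReal_nonneg s'
    have hn' : TimeKind.toReal s = n := hn.symm
    have hm' : TimeKind.toReal s' = m := hm.symm
    rw [toReal_add, toReal_one, hn', hm'] at h1
    rw [hn'] at h2
    rw [hm'] at h3
    norm_cast at h1 h2 h3
    have h4 : n = 0 ∨ m = 0 := by omega
    refine h4.imp (fun h => toReal_injective ?_) (fun h => toReal_injective ?_)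
    · rw [hn', h, Int.cast_zero]; rfl
    · rw [hm', h, Int.cast_zero]; rfl
  rcases key with rfl | rfl
  · exact Or.inl ⟨rfl, by rwa [zero_add] at h⟩
  · exact Or.inr ⟨by rwa [add_zero] at h, rfl⟩

/-- The two integrability assumptions, in discrete and in continuous time, in a common form: one
integrable function dominates the logarithms of the norms over both parts of a unit time step. -/
theorem Integrability.exists_bound (hI : Integrability μ θ U) :
    ∃ g : Ω → ℝ, Measurable g ∧ Integrable g μ ∧ (∀ ω, 0 ≤ g ω) ∧
      ∀ᵐ ω ∂μ, ∀ s s' : k.TPos, s + s' = k.one →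
        Real.posLog ‖U s ω‖ ≤ g ω ∧ Real.posLog ‖U s' (θ (s : k.T) ω)‖ ≤ g ω := by
  obtain ⟨G, hGm, hG, hGb⟩ : ∃ G : Ω → ENNReal, AEMeasurable G μ ∧ ∫⁻ ω, G ω ∂μ < ⊤ ∧
      ∀ ω, ∀ s s' : k.TPos, s + s' = k.one →
        ENNReal.ofReal (Real.posLog ‖U s ω‖) ≤ G ω ∧
        ENNReal.ofReal (Real.posLog ‖U s' (θ (s : k.T) ω)‖) ≤ G ω := by
    cases k with
    | discrete =>
      have h := hI.discrete rfl
      refine ⟨fun ω => ENNReal.ofReal (Real.posLog ‖U TimeKind.discrete.one ω‖),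
        h.aestronglyMeasurable.aemeasurable.ennreal_ofReal, ?_, fun ω s s' hss => ?_⟩
      · have := h.hasFiniteIntegral
        rwa [hasFiniteIntegral_iff_ofReal (Eventually.of_forall fun _ => Real.posLog_nonneg)]
          at this
      · have h0 : ∀ ω, Real.posLog ‖U 0 ω‖ = 0 := fun ω => by
          rw [hI.system.map_zero, Real.posLog_eq_zero_iff, abs_of_nonneg (norm_nonneg _)]
          exact ContinuousLinearMap.norm_id_le
        rcases time_eq_zero_or_one hss with ⟨rfl, rfl⟩ | ⟨rfl, rfl⟩
        · refine ⟨by simp [h0], ?_⟩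
          rw [Nonneg.coe_zero, hI.base.map_zero]
        · exact ⟨le_rfl, by simp [h0]⟩
    | continuous =>
      obtain ⟨⟨m1, i1⟩, ⟨m2, i2⟩⟩ := hI.continuous rfl
      refine ⟨_, m1.add m2, ?_, fun ω s s' hss => ⟨?_, ?_⟩⟩
      · simp only [Pi.add_apply]
        rw [lintegral_add_left' m1]
        exact ENNReal.add_lt_top.2 ⟨i1, i2⟩
      · have hs : s ≤ TimeKind.continuous.one := by
          rw [← hss]; exact le_add_of_nonneg_right s'.2
        exact le_add_right (le_iSup (fun s : {s : TimeKind.continuous.TPos // s ≤ TimeKind.one _} =>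
          ENNReal.ofReal (Real.posLog ‖U s ω‖)) ⟨s, hs⟩)
      · exact le_add_left (le_iSup (fun p : {p : TimeKind.continuous.TPos ×
          TimeKind.continuous.TPos // p.1 + p.2 = TimeKind.one _} =>
          ENNReal.ofReal (Real.posLog ‖U p.1.2 (θ (p.1.1 : TimeKind.continuous.T) ω)‖))
          ⟨(s, s'), hss⟩)
  have hG' : ∫⁻ ω, hGm.mk G ω ∂μ < ⊤ := by rwa [← lintegral_congr_ae hGm.ae_eq_mk]
  refine ⟨fun ω => (hGm.mk G ω).toReal, hGm.measurable_mk.ennreal_toReal,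
    integrable_toReal_of_lintegral_ne_top hGm.measurable_mk.aemeasurable hG'.ne,
    fun ω => ENNReal.toReal_nonneg, ?_⟩
  filter_upwards [hGm.ae_eq_mk, ae_lt_top hGm.measurable_mk hG'.ne] with ω h1 h2 s s' hss
  obtain ⟨h3, h4⟩ := hGb ω s s' hss
  rw [h1] at h3 h4
  exact ⟨(ENNReal.ofReal_le_iff_le_toReal h2.ne).1 h3,
    (ENNReal.ofReal_le_iff_le_toReal h2.ne).1 h4⟩

/-- A growth rate along the integers is a growth rate along all times, if the logarithms of the
norms within the unit time steps are sublinear. -/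
theorem tendsto_growthRate_of_natTime (hU : IsMLSPS θ U) (hθ : IsErgodicMetricDS μ θ) {ω : Ω}
    {u : X} (hne : ∀ t, U t ω u ≠ 0) {b : ℕ → ℝ} (hb0 : ∀ n, 0 ≤ b n)
    (hb : Tendsto (fun n : ℕ => b n / n) atTop (𝓝 0))
    (hbound : ∀ n, ∀ s s' : k.TPos, s + s' = k.one →
        Real.posLog ‖U s (θ (natTime k n : k.T) ω)‖ ≤ b n ∧
        Real.posLog ‖U s' (θ (s : k.T) (θ (natTime k n : k.T) ω))‖ ≤ b n)
    {L : EReal}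
    (hL : Tendsto (fun n : ℕ => ((Real.log ‖U (natTime k n) ω u‖ / n : ℝ) : EReal)) atTop (𝓝 L)) :
    Tendsto (growthRate U ω u) atTop (𝓝 L) := by
  rw [show growthRate U ω u = _ from funext fun t => growthRate_eq (hne t)]
  set x : ℕ → ℝ := fun n => Real.log ‖U (natTime k n) ω u‖ with hx
  set N : k.TPos → ℕ := fun t => ⌊TimeKind.toReal t⌋₊ with hN
  have hNt : Tendsto N atTop atTop := tendsto_nat_floor_atTop.comp tendsto_toReal_atTop
  have hNt1 : Tendsto (fun t => N t + 1) atTop atTop := (tendsto_add_atTop_nat 1).comp hNt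
  have hratio : Tendsto (fun t => (N t : ℝ) / TimeKind.toReal t) atTop (𝓝 1) :=
    (tendsto_nat_floor_div_atTop (R := ℝ)).comp tendsto_toReal_atTop
  have hratio1 : Tendsto (fun t => ((N t + 1 : ℕ) : ℝ) / TimeKind.toReal t) atTop (𝓝 1) := by
    have := hratio.add (tendsto_const_div_time (k := k) 1)
    rw [add_zero] at this
    refine this.congr fun t => ?_
    push_cast
    rw [add_div]
  have hb1 : Tendsto (fun n : ℕ => -(b n / (n + 1 : ℕ))) atTop (𝓝 0) := by
    rw [← neg_zero]
    refine Tendsto.neg (squeeze_zero' (Eventually.of_forall fun n => by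
      have := hb0 n; positivity) ?_ hb)
    filter_upwards [eventually_gt_atTop 0] with n hn
    have hn' : (0 : ℝ) < n := Nat.cast_pos.2 hn
    have := hb0 n
    gcongr
    exact Nat.le_succ n
  have hupper := tendsto_coe_mul_add (hL.comp hNt) hratio (hb.comp hNt)
  have hlower := tendsto_coe_mul_add (hL.comp hNt1) hratio1 (hb1.comp hNt)
  have hpos : ∀ᶠ t : k.TPos in atTop, 0 < N t := hNt.eventually_gt_atTop 0
  have hstep : ∀ t : k.TPos, x (N t + 1) - b (N t) ≤ Real.log ‖U t ω u‖ ∧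
      Real.log ‖U t ω u‖ ≤ x (N t) + b (N t) := by
    intro t
    obtain ⟨s, s', hs, hs'⟩ := exists_natTime_add_eq t
    change s + natTime k (N t) = t at hs
    obtain ⟨h1, h2⟩ := hbound (N t) s s' (by rw [add_comm, hs'])
    have e1 : U s (θ (natTime k (N t) : k.T) ω) (U (natTime k (N t)) ω u) = U t ω u := by
      rw [hU.cocycle_apply, hs]
    have e2 : U s' (θ (s : k.T) (θ (natTime k (N t) : k.T) ω)) (U t ω u) =
        U (natTime k (N t + 1)) ω u := by
      have h3 : θ (s : k.T) (θ (natTime k (N t) : k.T) ω) = θ (t : k.T) ω := by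
        rw [← hθ.map_add, ← Nonneg.coe_add, add_comm, hs]
      have h4 : s' + t = natTime k (N t + 1) := by
        calc s' + t = s' + (s + natTime k (N t)) := by rw [hs]
          _ = _ := by rw [← add_assoc, hs', natTime_succ']
      rw [h3, hU.cocycle_apply, h4]
    have h5 := log_norm_apply_le (hne _) (by rw [e1]; exact hne t)
    have h6 := log_norm_apply_le (hne t) (by rw [e2]; exact hne _)
    rw [e1] at h5
    rw [e2] at h6
    simp only [hx]
    constructor <;> linarith
  refine tendsto_of_tendsto_of_tendsto_of_le_of_le' hlower hupper ?_ ?_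
  · filter_upwards [hpos, eventually_toReal_pos] with t hNpos ht
    refine EReal.coe_le_coe_iff.2 ?_
    refine le_of_eq_of_le ?_ ((div_le_div_iff_of_pos_right ht).2 (hstep t).1)
    have : ((N t + 1 : ℕ) : ℝ) ≠ 0 := by positivity
    simp only [Function.comp_apply]
    field_simp
    ring
  · filter_upwards [hpos, eventually_toReal_pos] with t hNpos ht
    refine EReal.coe_le_coe_iff.2 ?_
    refine le_of_le_of_eq ((div_le_div_iff_of_pos_right ht).2 (hstep t).2) ?_
    have : (N t : ℝ) ≠ 0 := Nat.cast_ne_zero.2 hNpos.ne'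
    simp only [Function.comp_apply, hx]
    field_simp

end Growth

/-! ### Principal Lyapunov exponents -/

section Exponents

variable {Ω : Type*} [MeasurableSpace Ω] {k : TimeKind} {μ : Measure Ω} {θ : k.T → Ω → Ω}
  {X : Type*} [NormedAddCommGroup X] [NormedSpace ℝ X] [MeasurableSpace X]
  {U : k.TPos → Ω → X →L[ℝ] X} {C : Set X} {e : X} {κ : Ω → ℝ}

/-- Beyond time `1` no orbit grows faster than that of a nonzero nonnegative vector. -/
theorem Focusing.exists_norm_le (hL : IsSeparableBanachLattice C) (hF : Focusing μ θ U C e κ)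
    (ω : Ω) {w : X} (hw : w ∈ C) (hw0 : w ≠ 0) (u : X) :
    ∃ c : ℝ, 0 < c ∧ ∀ t : k.TPos, k.one ≤ t → ‖U t ω u‖ ≤ c * ‖U t ω w‖ := by
  have hC := hL.cone
  have hP := hF.positivity
  have hpos : ∀ v ∈ C, ∃ c : ℝ, 0 ≤ c ∧ ∀ t : k.TPos, k.one ≤ t →
      ‖U t ω v‖ ≤ c * ‖U t ω w‖ := by
    intro v hv
    by_cases hv0 : v = 0
    · exact ⟨0, le_rfl, fun t _ => by simp [hv0]⟩
    obtain ⟨m, hm, -, h⟩ := (hF.focusesOn ω).isClose_map hC (hF.one_le ω) hv hv0 hw hw0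
    have hκ := hF.one_le ω
    set c := (1 + (κ ω ^ 2 - 1)) * m with hc
    have hc0 : 0 ≤ c := by
      have : c = κ ω ^ 2 * m := by rw [hc]; ring
      rw [this]; positivity
    refine ⟨c, hc0, fun t ht => ?_⟩
    obtain ⟨r, rfl⟩ := exists_add_eq ht
    rw [← hP.system.cocycle_apply, ← hP.system.cocycle_apply,
      ← Real.norm_of_nonneg hc0, ← norm_smul]
    refine hL.norm_le (hP.map_mem _ _ (hP.map_mem _ _ hv)) ?_
    have := hP.map_mem r (θ (k.one : k.T) ω) h
    simpa using this
  obtain ⟨p, hp, q, hq, rfl⟩ := hL.exists_sub_eq u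
  obtain ⟨c, hc, h⟩ := hpos p hp
  obtain ⟨d, hd, h'⟩ := hpos q hq
  refine ⟨c + d + 1, by positivity, fun t ht => ?_⟩
  rw [map_sub]
  refine (norm_sub_le _ _).trans ?_
  nlinarith [h t ht, h' t ht, norm_nonneg (U t ω w)]

theorem Focusing.limsup_growthRate_le (hL : IsSeparableBanachLattice C)
    (hF : Focusing μ θ U C e κ) {ω : Ω} {w : X} (hw : w ∈ C) (hw0 : w ≠ 0) {l : EReal}
    (h : Tendsto (growthRate U ω w) atTop (𝓝 l)) (u : X) :
    limsup (growthRate U ω u) atTop ≤ l := by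
  obtain ⟨c, hc, hcu⟩ := hF.exists_norm_le hL ω hw hw0 u
  have hne := fun t => hF.map_ne_zero t ω hw hw0
  rw [show growthRate U ω w = _ from funext fun t => growthRate_eq (hne t)] at h
  have h1 := tendsto_coe_mul_add h (tendsto_const_nhds (x := (1 : ℝ)))
    (tendsto_const_div_time (Real.log c))
  rw [← h1.limsup_eq]
  refine limsup_le_limsup ?_
  filter_upwards [eventually_ge_atTop k.one] with t ht
  have hpos : 0 < ‖U t ω w‖ := norm_pos_iff.2 (hne t)
  refine (growthRate_mono (mul_pos hc hpos) (hcu t ht)).trans_eq ?_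
  rw [Real.log_mul hc.ne' hpos.ne']
  congr 1
  ring

/-- The growth rate of the equivariant direction is almost everywhere the same, and is a principal
Lyapunov exponent. -/
theorem Focusing.exists_exponent [IsProbabilityMeasure μ] [CompleteSpace X] [BorelSpace X]
    (hL : IsSeparableBanachLattice C) (hI : Integrability μ θ U) (hF : Focusing μ θ U C e κ) :
    ∃ l, IsPrincipalLyapunovExponent μ θ U C l := by
  have hθ := hI.base
  have hU := hI.system
  obtain ⟨S, w, hS, hSi, hS1, hwm, hwS⟩ := hF.exists_equivariant_direction hL hI.isComplete
  have := hL.separable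
  have : SecondCountableTopology X := UniformSpace.secondCountable_of_separable X
  have hSae : ∀ᵐ ω ∂μ, ω ∈ S := (mem_ae_iff_prob_eq_one hS).2 hS1
  have hw0 : ∀ ω ∈ S, w ω ≠ 0 := fun ω hω h0 => by simpa [h0] using (hwS ω hω).2.1
  have hne : ∀ ω ∈ S, ∀ t, U t ω (w ω) ≠ 0 := fun ω hω t =>
    hF.map_ne_zero t ω (hwS ω hω).1 (hw0 ω hω)
  have hstep : ∀ ω ∈ S, ∀ s : k.TPos,
      U s ω (w ω) = ‖U s ω (w ω)‖ • w (θ (s : k.T) ω) := fun ω hω s => by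
    rw [← (hwS ω hω).2.2 s, norm_smul_unit (hne ω hω s)]
  have hUm : ∀ t, Measurable fun ω => U t ω (w ω) := fun t =>
    hU.measurable.comp (measurable_const.prodMk (measurable_id.prodMk hwm))
  obtain ⟨g, hgm, hgi, hg0, hgb⟩ := hI.exists_bound
  set T : Ω → Ω := θ (k.one : k.T) with hT
  have hTmp : MeasurePreserving T μ μ := hθ.preserving _
  set f : Ω → ℝ := fun ω => Real.log ‖U k.one ω (w ω)‖ with hf
  have hfm : Measurable f := (hUm _).norm.log
  have hfi : Integrable (fun ω => max (f ω) 0) μ := by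
    refine hgi.mono' (hfm.max measurable_const).aestronglyMeasurable ?_
    filter_upwards [hgb, hSae] with ω h1 h2
    rw [Real.norm_of_nonneg (le_max_right _ _)]
    refine max_le ?_ (hg0 ω)
    have h3 := log_norm_apply_le (hw0 ω h2) (hne ω h2 k.one)
    rw [(hwS ω h2).2.1, Real.log_one, add_zero] at h3
    exact h3.trans (h1 k.one 0 (add_zero _)).1
  have hsum : ∀ n, ∀ ω ∈ S, birkhoffSum T f n ω = Real.log ‖U (natTime k n) ω (w ω)‖ := by
    intro n
    induction n with
    | zero =>
      intro ω hω
      rw [birkhoffSum_zero, natTime_zero, hU.map_zero, ContinuousLinearMap.id_apply,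
        (hwS ω hω).2.1, Real.log_one]
    | succ n ih =>
      intro ω hω
      have hω' := hSi.apply_mem (k.one : k.T) hω
      rw [birkhoffSum_succ', ih _ hω', natTime_succ, ← hU.cocycle_apply, hstep ω hω k.one,
        map_smul, norm_smul, norm_norm, Real.log_mul (norm_ne_zero_iff.2 (hne ω hω _))
        (norm_ne_zero_iff.2 (hne _ hω' _))]
  have hgb' : ∀ᵐ ω ∂μ, ∀ n, ∀ s s' : k.TPos, s + s' = k.one →
      Real.posLog ‖U s (θ (natTime k n : k.T) ω)‖ ≤ g (T^[n] ω) ∧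
      Real.posLog ‖U s' (θ (s : k.T) (θ (natTime k n : k.T) ω))‖ ≤ g (T^[n] ω) := by
    refine ae_all_iff.2 fun n => ?_
    filter_upwards [(hTmp.iterate n).quasiMeasurePreserving.ae hgb] with ω hω
    rwa [← iterate_one hθ]
  have hae : ∀ᵐ ω ∂μ, ω ∈ S ∧ ∃ L : EReal, L ≠ ⊤ ∧
      Tendsto (growthRate U ω (w ω)) atTop (𝓝 L) := by
    filter_upwards [hSae, ae_exists_tendsto_birkhoffSum_div hTmp hfm hfi,
      ae_tendsto_comp_iterate_div hTmp hgm hgi hg0, hgb'] with ω h1 ⟨L, h2, h3⟩ h4 h5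
    refine ⟨h1, L, h2, ?_⟩
    simp_rw [fun n => hsum n ω h1] at h3
    exact tendsto_growthRate_of_natTime hU hθ (hne ω h1) (fun n => hg0 _) h4 h5 h3
  have hiff : ∀ (s : k.TPos), ∀ ω ∈ S, ∀ L : EReal,
      Tendsto (growthRate U ω (w ω)) atTop (𝓝 L) ↔
        Tendsto (growthRate U (θ (s : k.T) ω) (w (θ (s : k.T) ω))) atTop (𝓝 L) :=
    fun s ω hω L => tendsto_growthRate_shift_iff (norm_pos_iff.2 (hne ω hω s)) (hne ω hω)
      (hne _ (hSi.apply_mem _ hω)) (fun t => by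
        rw [← hU.cocycle_apply, ← map_smul, ← hstep ω hω s]) L
  have hiff' : ∀ (t : k.T), ∀ ω ∈ S, ∀ L : EReal,
      Tendsto (growthRate U ω (w ω)) atTop (𝓝 L) →
        Tendsto (growthRate U (θ t ω) (w (θ t ω))) atTop (𝓝 L) := by
    intro t ω hω L hL
    rcases le_total 0 t with ht | ht
    · exact (hiff ⟨t, ht⟩ ω hω L).1 hL
    · refine (hiff ⟨-t, neg_nonneg.2 ht⟩ _ (hSi.apply_mem t hω) L).2 ?_
      simp only
      rwa [hθ.apply_neg]
  obtain ⟨S', hS', hSi', hS1', hSP⟩ := hθ.exists_invariant_of_ae hI.isComplete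
    (P := fun ω => ω ∈ S ∧ ∃ L : EReal, L ≠ ⊤ ∧ Tendsto (growthRate U ω (w ω)) atTop (𝓝 L))
    (fun t ω ⟨h1, L, h2, h3⟩ => ⟨hSi.apply_mem t h1, L, h2, hiff' t ω h1 L h3⟩) hae
  set Λ : Ω → EReal := fun ω => limsup (fun n : ℕ => growthRate U ω (w ω) (natTime k n)) atTop
    with hΛ
  have hΛm : Measurable Λ := Measurable.limsup fun n =>
    (measurable_const.mul ((hUm _).enorm.ennreal_log))
  have hΛlim : ∀ ω L, Tendsto (growthRate U ω (w ω)) atTop (𝓝 L) → Λ ω = L := fun ω L h =>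
    (h.comp tendsto_natTime).limsup_eq
  obtain ⟨l, hSm, hSinv, hSl⟩ := hθ.exists_const hS' hSi' hS1' hΛm (fun t ω hω => by
    obtain ⟨h1, L, -, h3⟩ := hSP ω hω
    rw [hΛlim ω L h3, hΛlim _ L (hiff' t ω h1 L h3)])
  have hlim : ∀ ω ∈ S' ∩ Λ ⁻¹' {l}, l ≠ ⊤ ∧ Tendsto (growthRate U ω (w ω)) atTop (𝓝 l) := by
    rintro ω ⟨h1, h2⟩
    obtain ⟨-, L, h3, h4⟩ := hSP ω h1
    have h5 : Λ ω = l := h2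
    rw [hΛlim ω L h4] at h5
    subst h5
    exact ⟨h3, h4⟩
  have hmemS : ∀ ω ∈ S' ∩ Λ ⁻¹' {l}, ω ∈ S := fun ω hω => (hSP ω hω.1).1
  refine ⟨l, S' ∩ Λ ⁻¹' {l}, fun ω => Submodule.span ℝ {w ω}, w, ?_⟩
  refine
    { measurableSet := hSm
      invariant := hSinv
      measure_eq_one := hSl
      measurable := hwm.comp measurable_subtype_coe
      pos := fun ω hω => ⟨(hwS ω (hmemS ω hω)).1, hw0 ω (hmemS ω hω)⟩
      eq_span := fun ω _ => rfl
      map_eq := fun ω hω t => ?_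
      ne_top := ?_
      tendsto := fun ω hω => (hlim ω hω).2
      limsup_le := fun ω hω u _ => hF.limsup_growthRate_le hL (hwS ω (hmemS ω hω)).1
        (hw0 ω (hmemS ω hω)) (hlim ω hω).2 u }
  · rw [Submodule.map_span, Set.image_singleton, ContinuousLinearMap.coe_coe,
      hstep ω (hmemS ω hω) t]
    exact Submodule.span_singleton_smul_eq
      (isUnit_iff_ne_zero.2 (norm_ne_zero_iff.2 (hne ω (hmemS ω hω) t))) _
  · obtain ⟨ω, hω⟩ : (S' ∩ Λ ⁻¹' {l}).Nonempty := by
      refine nonempty_of_measure_ne_zero (μ := μ) ?_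
      rw [hSl]
      exact one_ne_zero
    exact (hlim ω hω).1

/-- Exponents are ordered as soon as the systems are ordered on the cone at one positive time. -/
theorem IsPrincipalLyapunovExponent.le_of_le [IsProbabilityMeasure μ]
    {U₁ U₂ : k.TPos → Ω → X →L[ℝ] X} (hL : IsSeparableBanachLattice C)
    (hP₁ : Positivity μ θ U₁ C) (hP₂ : Positivity μ θ U₂ C) {t₀ : k.TPos} (ht₀ : t₀ ≠ 0)
    (hle : ∀ᵐ ω ∂μ, ∀ u ∈ C, ConeLE C (U₁ t₀ ω u) (U₂ t₀ ω u)) {l₁ l₂ : EReal}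
    (h₁ : IsPrincipalLyapunovExponent μ θ U₁ C l₁)
    (h₂ : IsPrincipalLyapunovExponent μ θ U₂ C l₂) : l₁ ≤ l₂ := by
  obtain ⟨S₁, E₁, w₁, h₁⟩ := h₁
  obtain ⟨S₂, E₂, w₂, h₂⟩ := h₂
  have hC := hL.cone
  have hθ := hP₁.base
  have hae : ∀ᵐ ω ∂μ, ∀ n : ℕ, ∀ u ∈ C,
      ConeLE C (U₁ t₀ (θ ((n • t₀ : k.TPos) : k.T) ω) u)
        (U₂ t₀ (θ ((n • t₀ : k.TPos) : k.T) ω) u) :=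
    ae_all_iff.2 fun n => (hθ.preserving _).quasiMeasurePreserving.ae hle
  have hS₁ : ∀ᵐ ω ∂μ, ω ∈ S₁ := (mem_ae_iff_prob_eq_one h₁.measurableSet).2 h₁.measure_eq_one
  have hS₂ : ∀ᵐ ω ∂μ, ω ∈ S₂ := (mem_ae_iff_prob_eq_one h₂.measurableSet).2 h₂.measure_eq_one
  obtain ⟨ω, hω, hω₁, hω₂⟩ := (hae.and (hS₁.and hS₂)).exists
  obtain ⟨hwC, hw0⟩ := h₁.pos ω hω₁
  have hcmp : ∀ n : ℕ, U₂ (n • t₀) ω (w₁ ω) - U₁ (n • t₀) ω (w₁ ω) ∈ C := by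
    intro n
    induction n with
    | zero =>
      rw [zero_nsmul, hP₁.system.map_zero, hP₂.system.map_zero, sub_self]
      exact hC.zero_mem
    | succ n ih =>
      rw [succ_nsmul', ← hP₁.system.cocycle_apply, ← hP₂.system.cocycle_apply]
      have h3 := hP₂.map_mem t₀ (θ ((n • t₀ : k.TPos) : k.T) ω) ih
      have h4 := hω n _ (hP₁.map_mem (n • t₀) ω hwC)
      rw [map_sub] at h3
      have h5 := hC.add_mem h3 h4
      rwa [sub_add_sub_cancel] at h5
  have htend := tendsto_nsmul_atTop ht₀
  have hlim := (h₁.tendsto ω hω₁).comp htend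
  calc l₁ = limsup (fun n : ℕ => growthRate U₁ ω (w₁ ω) (n • t₀)) atTop := hlim.limsup_eq.symm
    _ ≤ limsup (fun n : ℕ => growthRate U₂ ω (w₁ ω) (n • t₀)) atTop := by
      refine limsup_le_limsup (Eventually.of_forall fun n => ?_)
      refine mul_le_mul_of_nonneg_left (ENNReal.log_monotone ?_)
        (EReal.coe_nonneg.2 (one_div_nonneg.2 (toReal_nonneg _)))
      rw [← ofReal_norm, ← ofReal_norm]
      exact ENNReal.ofReal_le_ofReal (hL.norm_le (hP₁.map_mem _ _ hwC) (hcmp n))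
    _ ≤ limsup (growthRate U₂ ω (w₁ ω)) atTop := by
      rw [show (fun n : ℕ => growthRate U₂ ω (w₁ ω) (n • t₀)) =
        growthRate U₂ ω (w₁ ω) ∘ fun n : ℕ => n • t₀ from rfl, limsup_comp]
      exact limsup_le_limsup_of_le htend
    _ ≤ l₂ := h₂.limsup_le ω hω₂ _ hw0

/-- Uniqueness is the comparison of the system with itself. -/
theorem SeparationHypotheses.existsUnique_exponent [IsProbabilityMeasure μ] [CompleteSpace X]
    [BorelSpace X] (h : SeparationHypotheses μ θ U C) :
    ∃! l, IsPrincipalLyapunovExponent μ θ U C l := by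
  obtain ⟨e, κ, e', κ', hF, -⟩ := h.strongFocusing
  obtain ⟨l, hl⟩ := hF.exists_exponent h.lattice h.integrability
  have hrefl : ∀ᵐ ω ∂μ, ∀ u ∈ C, ConeLE C (U k.one ω u) (U k.one ω u) :=
    Eventually.of_forall fun ω u _ => by
      rw [ConeLE, sub_self]; exact h.lattice.cone.zero_mem
  have hcomp : ∀ l₁ l₂, IsPrincipalLyapunovExponent μ θ U C l₁ →
      IsPrincipalLyapunovExponent μ θ U C l₂ → l₁ ≤ l₂ := fun l₁ l₂ h₁ h₂ =>
    h₁.le_of_le h.lattice h.positivity h.positivity one_ne_zero_time hrefl h₂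
  exact ⟨l, hl, fun l' hl' => le_antisymm (hcomp _ _ hl' hl) (hcomp _ _ hl hl')⟩

end Exponents

end SkewProduct

theorem mainTheorem5 {Ω : Type*} [MeasurableSpace Ω]
    (μ : MeasureTheory.Measure Ω) [MeasureTheory.IsProbabilityMeasure μ]
    {X : Type*} [NormedAddCommGroup X] [NormedSpace ℝ X] [CompleteSpace X]
    [MeasurableSpace X] [BorelSpace X] (C : Set X)
    (k : SkewProduct.TimeKind) (θ : k.T → Ω → Ω)
    (U₁ U₂ : k.TPos → Ω → X →L[ℝ] X)
    (h₁ : SkewProduct.SeparationHypotheses μ θ U₁ C)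
    (h₂ : SkewProduct.SeparationHypotheses μ θ U₂ C)
    (t₀ : k.TPos) (ht₀ : t₀ ≠ 0)
    (hle : ∀ᵐ ω ∂μ, ∀ u ∈ C, SkewProduct.ConeLE C (U₁ t₀ ω u) (U₂ t₀ ω u)) :
    (∃! l₁, SkewProduct.IsPrincipalLyapunovExponent μ θ U₁ C l₁) ∧
    (∃! l₂, SkewProduct.IsPrincipalLyapunovExponent μ θ U₂ C l₂) ∧
    ∀ l₁ l₂ : EReal, SkewProduct.IsPrincipalLyapunovExponent μ θ U₁ C l₁ →
      SkewProduct.IsPrincipalLyapunovExponent μ θ U₂ C l₂ → l₁ ≤ l₂ :=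
  ⟨h₁.existsUnique_exponent, h₂.existsUnique_exponent, fun _ _ hl₁ hl₂ =>
    hl₁.le_of_le h₁.lattice h₁.positivity h₂.positivity ht₀ hle hl₂⟩
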